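/- Let $m,n,d\ge 1$, let $\mathbf\Sigma\in\mathbb R^{m\times n}$ have rank $d$ with singular values $\sigma_1\ge\dots\ge\sigma_d>0$, let $\kappa=\sigma_1/\sigma_d$, and let $$f(\mathbf U,\mathbf V)=\tfrac12\|\mathbf U\mathbf V^\top-\mathbf\Sigma\|_F^2,\qquad \mathbf U\in\mathbb R^{m\times d},\ \mathbf V\in\mathbb R^{n\times d}.$$ Gradient descent with constant step size $\eta>0$ is $$\mathbf U_{t+1}=\mathbf U_t+\eta(\mathbf\Sigma-\mathbf U_t\mathbf V_t^\top)\mathbf V_t,\qquad \mathbf V_{t+1}=\mathbf V_t+\eta(\mathbf\Sigma-\mathbf U_t\mathbf V_t^\top)^\top\mathbf U_t .$$ There are universal constants $k\in\mathbb N$ and $C>0$, and for every failure probability $\rho\in(0,1)$ there are constants $c_1,c_2>0$ depending only on $\rho$, such that the following holds for all such $m,n,d,\mathbf\Sigma$. Let $$0<\varepsilon\le \frac{c_1}{\ln^k((m+n)\kappa)}\cdot\frac{\sigma_d}{\sqrt{d^3\sigma_1}\,(m+n)},$$ and let all entries of $\mathbf U_0$ and $\mathbf V_0$ be independent $N(0,\varepsilon^2)$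 random variables. Then there is $T_{\rm total}(\delta,\eta)$, not depending on the realization of the initialization, such that for every $\delta>0$ and every step size $0<\eta\le c_2\,\frac{\sigma_d\varepsilon^2}{d\sigma_1^3}$: 1. $T_{\rm total}(\delta,\eta)\le C\Big(\frac1{\eta\sigma_d}\ln\frac{d\sigma_d}{\varepsilon^2}+\frac1{\eta\sigma_d}\max\{0,\ln\frac{\sigma_d^2}{\delta}\}\Big)$; 2. if moreover $\delta\le\min\{\sigma_d,\sigma_d^2\}$, then also $T_{\rm total}(\delta,\eta)\le C\Big(\frac1{\eta\sigma_d}\ln\frac{d\sigma_d}{\varepsilon}+\frac1{\eta\sigma_d}\ln\frac{\sigma_d}{\delta}\Big)$; 3. with probability at least $1-\rho$ over the initialization, $f(\mathbf U_t,\mathbf V_t)\le\delta$ for all integers $t\ge 0$ with $t>T_{\rm total}(\delta,\eta)$. -/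

import Mathlib

open scoped Matrix

noncomputable section

namespace MatFac

/-- The `i`-th largest singular value of a real matrix, counted from `0`:
`sval S 0` is `σ₁` and, for a matrix of rank `d ≥ 1`, `sval S (d - 1)` is the smallest
(nonzero) singular value `σ_d`. -/
def sval {m n : ℕ} (S : Matrix (Fin m) (Fin n) ℝ) (i : ℕ) : ℝ :=
  (Matrix.toEuclideanLin S).singularValues i

section Objective

open scoped Matrix.Norms.Frobenius

/-- The objective `f(U, V) = ½ ‖U Vᵀ - S‖_F²` (the norm here is the Frobenius norm). -/
def loss {m n d : ℕ} (S : Matrix (Fin m) (Fin n) ℝ)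
    (U : Matrix (Fin m) (Fin d) ℝ) (V : Matrix (Fin n) (Fin d) ℝ) : ℝ :=
  1 / 2 * ‖U * Vᵀ - S‖ ^ 2

end Objective

/-- One step of gradient descent with step size `η` (both factors are updated simultaneously). -/
def gdStep {m n d : ℕ} (S : Matrix (Fin m) (Fin n) ℝ) (η : ℝ)
    (W : Matrix (Fin m) (Fin d) ℝ × Matrix (Fin n) (Fin d) ℝ) :
    Matrix (Fin m) (Fin d) ℝ × Matrix (Fin n) (Fin d) ℝ :=
  (W.1 + η • ((S - W.1 * W.2ᵀ) * W.2), W.2 + η • ((S - W.1 * W.2ᵀ)ᵀ * W.1))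

/-- The iterate `(U_t, V_t)` of gradient descent with constant step size `η`
started from `(U₀, V₀) = W`. -/
def gdIter {m n d : ℕ} (S : Matrix (Fin m) (Fin n) ℝ) (η : ℝ)
    (W : Matrix (Fin m) (Fin d) ℝ × Matrix (Fin n) (Fin d) ℝ) (t : ℕ) :
    Matrix (Fin m) (Fin d) ℝ × Matrix (Fin n) (Fin d) ℝ :=
  (gdStep S η)^[t] W

/-- The law of a pair of arrays of sizes `m × d` and `n × d`, all of whose entries are
independent Gaussians with mean `0` and variance `ε²`. -/
def gaussianInit (m n d : ℕ) (ε : ℝ) :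
    MeasureTheory.Measure ((Fin m → Fin d → ℝ) × (Fin n → Fin d → ℝ)) :=
  (MeasureTheory.Measure.pi fun _ : Fin m => MeasureTheory.Measure.pi fun _ : Fin d =>
      ProbabilityTheory.gaussianReal 0 (Real.toNNReal (ε ^ 2))).prod
    (MeasureTheory.Measure.pi fun _ : Fin n => MeasureTheory.Measure.pi fun _ : Fin d =>
      ProbabilityTheory.gaussianReal 0 (Real.toNNReal (ε ^ 2)))

end MatFac

end

/-! Write `S = Φ H Ψᵀ` as a thin singular value decomposition. Let `A` and `B` be the half sum and
half difference of `Φᵀ U` and `Ψᵀ V`, let `J` and `K` be the parts of `U` and `V` orthogonal to the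
singular spaces, and let `P = S - U Vᵀ`.

Near the origin `H` makes `A` grow and `B` decay, while `J` and `K` never grow. The coupling that
could spoil this is the imbalance `UᵀU - VᵀV`. Gradient flow conserves it, and one gradient step
changes it by at most `η²` times the squared gradient. Since a step also lowers `‖P‖²` by at least
`η` times the squared gradient, the total change stays `O(r²)`, where `r` is the size of the
initialization (`Controlled.gdStep`). Bounded residual and bounded imbalance also bound both
factors.

There are two phases. While the smallest singular value of `A` is below `√σd / 4`, it gains a factor
`1 + η σd / 4` per step (`BelowBy.growth`). Afterwards `Φᵀ U = A + B` and `Ψᵀ V = A - B` are both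
well conditioned, so the gradient dominates the residual up to `‖J‖² ‖K‖²` (`gradient_dominated`).
As `J` contracts too, `‖P‖² + ‖J‖² ‖K‖²` decays geometrically (`Controlled.contraction`).

Randomness is needed only at time `0`: the initialization has norm at most `r`, by Markov's
inequality, and the smallest singular value of `A` is at least `s₀`. For the latter, a near-kernel
vector with a large `j`-th coordinate confines column `j` to a thin slab once the other columns are
frozen, and a Gaussian rarely falls into a slab (`gaussianInit_good`). -/

noncomputable section

namespace MatFac

open scoped Matrix.Norms.Frobenius

/-! ### Frobenius inner product calculus. -/

section FrobeniusInner

variable {p q r : Type*} [Fintype p] [Fintype q] [Fintype r]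

/-- The Frobenius inner product of two real matrices. -/
def ip (X Y : Matrix p q ℝ) : ℝ := ∑ i, ∑ j, X i j * Y i j

lemma ip_eq_trace (X Y : Matrix p q ℝ) : ip X Y = (Xᵀ * Y).trace := by
  simp only [ip, Matrix.trace, Matrix.diag_apply, Matrix.mul_apply, Matrix.transpose_apply]
  exact Finset.sum_comm

lemma norm_sq_eq_sum (X : Matrix p q ℝ) : ‖X‖ ^ 2 = ∑ i, ∑ j, X i j ^ 2 := by
  have h0 : (0 : ℝ) ≤ ∑ i, ∑ j, X i j ^ 2 :=
    Finset.sum_nonneg fun i _ => Finset.sum_nonneg fun j _ => sq_nonneg _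
  rw [Matrix.frobenius_norm_def, ← Real.sqrt_eq_rpow]
  simp only [Real.rpow_two, Real.norm_eq_abs, sq_abs]
  exact Real.sq_sqrt h0

lemma norm_sq_eq_ip (X : Matrix p q ℝ) : ‖X‖ ^ 2 = ip X X := by
  rw [norm_sq_eq_sum]; simp only [ip, sq]

lemma ip_comm (X Y : Matrix p q ℝ) : ip X Y = ip Y X := by
  simp only [ip, mul_comm]

lemma ip_add_right (X Y Z : Matrix p q ℝ) : ip X (Y + Z) = ip X Y + ip X Z := by
  simp only [ip, Matrix.add_apply, mul_add, Finset.sum_add_distrib]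

lemma ip_smul_right (c : ℝ) (X Y : Matrix p q ℝ) : ip X (c • Y) = c * ip X Y := by
  simp only [ip, Matrix.smul_apply, smul_eq_mul, Finset.mul_sum]
  exact Finset.sum_congr rfl fun i _ => Finset.sum_congr rfl fun j _ => by ring

lemma ip_neg_right (X Y : Matrix p q ℝ) : ip X (-Y) = -ip X Y := by
  simpa using ip_smul_right (-1) X Y

lemma ip_sub_right (X Y Z : Matrix p q ℝ) : ip X (Y - Z) = ip X Y - ip X Z := by
  rw [sub_eq_add_neg, ip_add_right, ip_neg_right]; ring

lemma ip_add_left (X Y Z : Matrix p q ℝ) : ip (X + Y) Z = ip X Z + ip Y Z := by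
  rw [ip_comm, ip_add_right, ip_comm Z X, ip_comm Z Y]

lemma ip_sub_left (X Y Z : Matrix p q ℝ) : ip (X - Y) Z = ip X Z - ip Y Z := by
  rw [ip_comm, ip_sub_right, ip_comm Z X, ip_comm Z Y]

lemma ip_mul_left (A : Matrix r p ℝ) (X : Matrix p q ℝ) (Y : Matrix r q ℝ) :
    ip (A * X) Y = ip X (Aᵀ * Y) := by
  simp only [ip_eq_trace, Matrix.transpose_mul, Matrix.mul_assoc]

lemma ip_transpose (X Y : Matrix p q ℝ) : ip Xᵀ Yᵀ = ip X Y := by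
  simp only [ip, Matrix.transpose_apply]
  exact Finset.sum_comm

lemma ip_mul_right (X : Matrix p q ℝ) (B : Matrix q r ℝ) (Y : Matrix p r ℝ) :
    ip (X * B) Y = ip X (Y * Bᵀ) := by
  rw [← ip_transpose, Matrix.transpose_mul, ip_mul_left, ← ip_transpose X,
    Matrix.transpose_mul, Matrix.transpose_transpose]

lemma norm_add_sq' (X Y : Matrix p q ℝ) : ‖X + Y‖ ^ 2 = ‖X‖ ^ 2 + 2 * ip X Y + ‖Y‖ ^ 2 := by
  simp only [norm_sq_eq_ip, ip_add_left, ip_add_right, ip_comm Y X]; ring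

lemma norm_sub_sq' (X Y : Matrix p q ℝ) : ‖X - Y‖ ^ 2 = ‖X‖ ^ 2 - 2 * ip X Y + ‖Y‖ ^ 2 := by
  simp only [norm_sq_eq_ip, ip_sub_left, ip_sub_right, ip_comm Y X]; ring

lemma abs_ip_le (X Y : Matrix p q ℝ) : |ip X Y| ≤ ‖X‖ * ‖Y‖ := by
  have h : ip X Y ^ 2 ≤ (‖X‖ * ‖Y‖) ^ 2 := by
    have := Finset.sum_mul_sq_le_sq_mul_sq (Finset.univ : Finset (p × q))
      (fun z => X z.1 z.2) (fun z => Y z.1 z.2)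
    simp only [Fintype.sum_prod_type] at this
    rw [mul_pow, norm_sq_eq_sum, norm_sq_eq_sum]
    exact this
  exact abs_le_of_sq_le_sq h (by positivity)

lemma ip_le (X Y : Matrix p q ℝ) : ip X Y ≤ ‖X‖ * ‖Y‖ := (le_abs_self _).trans (abs_ip_le X Y)

lemma norm_transpose_mul_self_le (X : Matrix p q ℝ) : ‖Xᵀ * X‖ ≤ ‖X‖ ^ 2 := by
  have := Matrix.frobenius_norm_mul Xᵀ X
  rw [Matrix.frobenius_norm_transpose] at this
  rw [sq]; exact this

end FrobeniusInner

/-! ### Singular value lower bounds and one gradient step. -/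

section Step

variable {m n d : ℕ}

/-- `BelowBy A s`: the smallest singular value of `A` (on its domain) is at least `s`. -/
def BelowBy (A : Matrix (Fin m) (Fin n) ℝ) (s : ℝ) : Prop :=
  ∀ (k : ℕ) (X : Matrix (Fin n) (Fin k) ℝ), s * ‖X‖ ≤ ‖A * X‖

lemma BelowBy.mono {A : Matrix (Fin m) (Fin n) ℝ} {s s' : ℝ} (h : BelowBy A s) (hs : s' ≤ s) :
    BelowBy A s' := fun k X =>
  (mul_le_mul_of_nonneg_right hs (norm_nonneg X)).trans (h k X)

lemma BelowBy.add {A B : Matrix (Fin m) (Fin n) ℝ} {s β : ℝ} (h : BelowBy A s) (hB : ‖B‖ ≤ β) :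
    BelowBy (A + B) (s - β) := fun k X => by
  have h1 := h k X
  have h2 := Matrix.frobenius_norm_mul B X
  have h3 : ‖A * X‖ ≤ ‖(A + B) * X‖ + ‖B * X‖ := by
    have : A * X = (A + B) * X - B * X := by rw [Matrix.add_mul]; abel
    rw [this]; exact norm_sub_le _ _
  have h4 := mul_le_mul_of_nonneg_right hB (norm_nonneg X)
  nlinarith

/-- For square matrices, a lower bound on the singular values passes to the transpose. -/
lemma BelowBy.transpose {A : Matrix (Fin d) (Fin d) ℝ} {s : ℝ} (hs : 0 < s) (h : BelowBy A s) :
    BelowBy Aᵀ s := by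
  have hu : IsUnit A := by
    rw [← Matrix.mulVec_injective_iff_isUnit]
    rw [← Matrix.coe_mulVecLin, ← LinearMap.ker_eq_bot, LinearMap.ker_eq_bot']
    intro v hv
    have h1 := h 1 (Matrix.of fun i _ => v i)
    have h2 : A * (Matrix.of fun i (_ : Fin 1) => v i) = 0 := by
      ext i j
      have := congrFun hv i
      simpa [Matrix.mul_apply, Matrix.mulVec, dotProduct] using this
    rw [h2, norm_zero] at h1
    have h3 : ‖(Matrix.of fun i (_ : Fin 1) => v i : Matrix (Fin d) (Fin 1) ℝ)‖ ≤ 0 := by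
      by_contra hc
      push Not at hc
      exact absurd h1 (not_le.mpr (mul_pos hs hc))
    have h4 := norm_le_zero_iff.mp h3
    ext i
    simpa using congrFun (congrFun h4 i) 0
  intro k Y
  have hd := (Matrix.isUnit_iff_isUnit_det A).mp hu
  have h1 := h k (A⁻¹ * Y)
  rw [← Matrix.mul_assoc, Matrix.mul_nonsing_inv A hd, Matrix.one_mul] at h1
  -- Cauchy–Schwarz for `⟨A⁻¹Y, AᵀY⟩ = ‖Y‖²`; the bound `s ‖A⁻¹Y‖ ≤ ‖Y‖` then moves `s` onto `Aᵀ`.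
  have h2 : ‖Y‖ ^ 2 ≤ ‖Aᵀ * Y‖ * ‖A⁻¹ * Y‖ := by
    have : ‖Y‖ ^ 2 = ip (A⁻¹ * Y) (Aᵀ * Y) := by
      rw [← ip_mul_left, ← Matrix.mul_assoc, Matrix.mul_nonsing_inv A hd, Matrix.one_mul,
        norm_sq_eq_ip]
    rw [this, mul_comm]; exact ip_le _ _
  rcases (norm_nonneg Y).eq_or_lt with h0 | h0
  · rw [← h0, mul_zero]; exact norm_nonneg _
  · have h3 : s * ‖Y‖ ^ 2 ≤ ‖Aᵀ * Y‖ * ‖Y‖ := by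
      have := mul_le_mul_of_nonneg_left h1 (norm_nonneg (Aᵀ * Y))
      nlinarith
    nlinarith

/-- Both factors are controlled by the imbalance and the product. -/
lemma norm_gram_sq_add (U : Matrix (Fin m) (Fin d) ℝ) (V : Matrix (Fin n) (Fin d) ℝ) :
    ‖Uᵀ * U‖ ^ 2 + ‖Vᵀ * V‖ ^ 2 = ‖Uᵀ * U - Vᵀ * V‖ ^ 2 + 2 * ‖U * Vᵀ‖ ^ 2 := by
  have h : ‖U * Vᵀ‖ ^ 2 = ip (Uᵀ * U) (Vᵀ * V) := by
    rw [norm_sq_eq_ip, ip_mul_left, ip_comm (Uᵀ * U), ip_mul_right, Matrix.mul_assoc]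
  rw [norm_sub_sq', h]; ring

/-- `‖U‖²` is the trace of `UᵀU`, its inner product with the identity, whose squared norm is `d`;
apply Cauchy–Schwarz. -/
lemma norm_pow_four_le (U : Matrix (Fin m) (Fin d) ℝ) : (‖U‖ ^ 2) ^ 2 ≤ d * ‖Uᵀ * U‖ ^ 2 := by
  have h : ‖U‖ ^ 2 = ip (1 : Matrix (Fin d) (Fin d) ℝ) (Uᵀ * U) := by
    rw [← ip_mul_left, Matrix.mul_one, norm_sq_eq_ip]
  have h1 : ‖(1 : Matrix (Fin d) (Fin d) ℝ)‖ ^ 2 = d := by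
    rw [norm_sq_eq_ip, ip_eq_trace]; simp
  have h2 := ip_le (1 : Matrix (Fin d) (Fin d) ℝ) (Uᵀ * U)
  rw [← h] at h2
  calc (‖U‖ ^ 2) ^ 2 ≤ (‖(1 : Matrix (Fin d) (Fin d) ℝ)‖ * ‖Uᵀ * U‖) ^ 2 := by gcongr
    _ = d * ‖Uᵀ * U‖ ^ 2 := by rw [mul_pow, h1]

/-- The residual after a gradient step. -/
lemma residual_gdStep (S : Matrix (Fin m) (Fin n) ℝ) (η : ℝ) (U : Matrix (Fin m) (Fin d) ℝ)
    (V : Matrix (Fin n) (Fin d) ℝ) :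
    S - (gdStep S η (U, V)).1 * (gdStep S η (U, V)).2ᵀ =
      (S - U * Vᵀ) - (η • ((S - U * Vᵀ) * V * Vᵀ + U * ((S - U * Vᵀ)ᵀ * U)ᵀ)
        + η ^ 2 • ((S - U * Vᵀ) * V * ((S - U * Vᵀ)ᵀ * U)ᵀ)) := by
  simp only [gdStep]
  generalize (S - U * Vᵀ)ᵀ * U = Y
  generalize hX : (S - U * Vᵀ) * V = X
  simp only [Matrix.transpose_add, Matrix.transpose_smul, Matrix.add_mul, Matrix.mul_add,
    Matrix.smul_mul, Matrix.mul_smul, smul_add, smul_smul, sq]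
  abel

/-- One gradient step decreases the squared residual by at least `η` times the squared gradient. -/
lemma norm_residual_gdStep_sq_le (S : Matrix (Fin m) (Fin n) ℝ) {η L : ℝ} (hη : 0 < η)
    (U : Matrix (Fin m) (Fin d) ℝ) (V : Matrix (Fin n) (Fin d) ℝ)
    (hU : ‖U‖ ^ 2 ≤ L) (hV : ‖V‖ ^ 2 ≤ L) (hP : ‖S - U * Vᵀ‖ ≤ L) (hL : η * L ≤ 1 / 8) :
    ‖S - (gdStep S η (U, V)).1 * (gdStep S η (U, V)).2ᵀ‖ ^ 2 ≤ ‖S - U * Vᵀ‖ ^ 2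
      - η * (‖(S - U * Vᵀ) * V‖ ^ 2 + ‖(S - U * Vᵀ)ᵀ * U‖ ^ 2) := by
  rw [residual_gdStep]
  set P := S - U * Vᵀ with hPdef
  set X := P * V with hX
  set Y := Pᵀ * U with hY
  have hL0 : 0 ≤ L := (sq_nonneg _).trans hU
  obtain ⟨l, hl0, rfl⟩ : ∃ l, 0 ≤ l ∧ L = l ^ 2 :=
    ⟨Real.sqrt L, Real.sqrt_nonneg _, (Real.sq_sqrt hL0).symm⟩
  have hU' : ‖U‖ ≤ l := abs_le_of_sq_le_sq' hU hl0 |>.2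
  have hV' : ‖V‖ ≤ l := abs_le_of_sq_le_sq' hV hl0 |>.2
  have x0 := norm_nonneg X
  have y0 := norm_nonneg Y
  have hy : ‖Y‖ ≤ l ^ 2 * l := by
    have := Matrix.frobenius_norm_mul Pᵀ U
    rw [Matrix.frobenius_norm_transpose] at this
    exact this.trans (mul_le_mul hP hU' (norm_nonneg _) (by positivity))
  have h1 : ip P (X * Vᵀ) = ‖X‖ ^ 2 := by rw [ip_comm, ip_mul_right, Matrix.transpose_transpose,
      ← hX, norm_sq_eq_ip]
  have h2 : ip P (U * Yᵀ) = ‖Y‖ ^ 2 := by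
    rw [ip_comm, ip_mul_left, ← ip_transpose, Matrix.transpose_transpose, Matrix.transpose_mul,
      Matrix.transpose_transpose, ← hY, norm_sq_eq_ip]
  have h3 : -(l ^ 2 * (‖X‖ * ‖Y‖)) ≤ ip P (X * Yᵀ) := by
    have e1 := abs_ip_le P (X * Yᵀ)
    have e2 := Matrix.frobenius_norm_mul X Yᵀ
    rw [Matrix.frobenius_norm_transpose] at e2
    have e3 : ‖P‖ * ‖X * Yᵀ‖ ≤ l ^ 2 * (‖X‖ * ‖Y‖) :=
      mul_le_mul hP e2 (norm_nonneg _) (by positivity)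
    linarith [neg_abs_le (ip P (X * Yᵀ))]
  -- The first-order decrease is `2η(‖X‖² + ‖Y‖²)`. Half of it pays for all remaining terms, since
  -- each carries an extra factor `η l² ≤ 1/8`.
  have h4 : ‖η • (X * Vᵀ + U * Yᵀ) + η ^ 2 • (X * Yᵀ)‖ ≤ η * l * (9 / 8 * (‖X‖ + ‖Y‖)) := by
    have e1 := Matrix.frobenius_norm_mul X Vᵀ
    have e2 := Matrix.frobenius_norm_mul U Yᵀ
    have e3 := Matrix.frobenius_norm_mul X Yᵀ
    rw [Matrix.frobenius_norm_transpose] at e1 e2 e3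
    have e4 : ‖η • (X * Vᵀ + U * Yᵀ)‖ ≤ η * (l * (‖X‖ + ‖Y‖)) := by
      rw [norm_smul, Real.norm_of_nonneg hη.le]
      refine mul_le_mul_of_nonneg_left ((norm_add_le _ _).trans ?_) hη.le
      have f1 := mul_le_mul_of_nonneg_left hV' x0
      have f2 := mul_le_mul_of_nonneg_right hU' y0
      linarith
    have e5 : ‖η ^ 2 • (X * Yᵀ)‖ ≤ η * l * (1 / 8 * ‖X‖) := by
      rw [norm_smul, Real.norm_of_nonneg (by positivity)]
      calc η ^ 2 * ‖X * Yᵀ‖ ≤ η ^ 2 * (‖X‖ * (l ^ 2 * l)) := by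
            gcongr; exact e3.trans (mul_le_mul_of_nonneg_left hy x0)
        _ = η * l * ((η * l ^ 2) * ‖X‖) := by ring
        _ ≤ _ := by gcongr
    have e6 : 0 ≤ η * l * ‖Y‖ := by positivity
    refine (norm_add_le _ _).trans ?_
    linarith
  have h5 : ‖η • (X * Vᵀ + U * Yᵀ) + η ^ 2 • (X * Yᵀ)‖ ^ 2
      ≤ (η * l * (9 / 8 * (‖X‖ + ‖Y‖))) ^ 2 := by gcongr
  rw [norm_sub_sq', ip_add_right, ip_smul_right, ip_smul_right, ip_add_right, h1, h2]
  have h6 : η ^ 2 * (l ^ 2 * (‖X‖ * ‖Y‖)) ≤ η * (1 / 8 * (‖X‖ * ‖Y‖)) := by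
    calc _ = η * ((η * l ^ 2) * (‖X‖ * ‖Y‖)) := by ring
      _ ≤ _ := by gcongr
  have h7 : (η * l * (9 / 8 * (‖X‖ + ‖Y‖))) ^ 2 ≤ η * (1 / 8 * (9 / 8 * (‖X‖ + ‖Y‖)) ^ 2) := by
    calc _ = η * ((η * l ^ 2) * (9 / 8 * (‖X‖ + ‖Y‖)) ^ 2) := by ring
      _ ≤ _ := by gcongr
  have h8 : -(η * (1 / 8 * (‖X‖ * ‖Y‖))) ≤ η ^ 2 * ip P (X * Yᵀ) := by
    have := mul_le_mul_of_nonneg_left h3 (sq_nonneg η)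
    linarith
  have h9 : 0 ≤ η * (‖X‖ - ‖Y‖) ^ 2 := by positivity
  have h10 : 0 ≤ η * ‖X‖ ^ 2 := by positivity
  have h11 : 0 ≤ η * ‖Y‖ ^ 2 := by positivity
  nlinarith

/-- The imbalance `UᵀU - VᵀV` changes only to second order in the step size. -/
lemma imbalance_gdStep (S : Matrix (Fin m) (Fin n) ℝ) (η : ℝ) (U : Matrix (Fin m) (Fin d) ℝ)
    (V : Matrix (Fin n) (Fin d) ℝ) :
    ‖(gdStep S η (U, V)).1ᵀ * (gdStep S η (U, V)).1 - (gdStep S η (U, V)).2ᵀ * (gdStep S η (U, V)).2‖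
      ≤ ‖Uᵀ * U - Vᵀ * V‖
        + η ^ 2 * (‖(S - U * Vᵀ) * V‖ ^ 2 + ‖(S - U * Vᵀ)ᵀ * U‖ ^ 2) := by
  -- Both Gram matrices have the same first-order term `η (Uᵀ P V + Vᵀ Pᵀ U)`, so it cancels.
  have h : (gdStep S η (U, V)).1ᵀ * (gdStep S η (U, V)).1
      - (gdStep S η (U, V)).2ᵀ * (gdStep S η (U, V)).2 = (Uᵀ * U - Vᵀ * V)
        + η ^ 2 • (((S - U * Vᵀ) * V)ᵀ * ((S - U * Vᵀ) * V)
          - ((S - U * Vᵀ)ᵀ * U)ᵀ * ((S - U * Vᵀ)ᵀ * U)) := by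
    simp only [gdStep]
    generalize S - U * Vᵀ = P
    simp only [Matrix.transpose_add, Matrix.transpose_smul, Matrix.add_mul, Matrix.mul_add,
      Matrix.smul_mul, Matrix.mul_smul, smul_add, smul_smul, sq, Matrix.transpose_mul,
      Matrix.transpose_transpose, Matrix.mul_assoc, smul_sub]
    abel
  rw [h]
  refine (norm_add_le _ _).trans ?_
  rw [norm_smul, Real.norm_of_nonneg (by positivity)]
  have := norm_sub_le (((S - U * Vᵀ) * V)ᵀ * ((S - U * Vᵀ) * V))
    (((S - U * Vᵀ)ᵀ * U)ᵀ * ((S - U * Vᵀ)ᵀ * U))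
  have h1 := norm_transpose_mul_self_le ((S - U * Vᵀ) * V)
  have h2 := norm_transpose_mul_self_le ((S - U * Vᵀ)ᵀ * U)
  gcongr
  linarith

end Step

end MatFac

namespace MatFac

open scoped Matrix.Norms.Frobenius

/-! ### Components along and orthogonal to the singular spaces. -/

section Components

variable {m n d k : ℕ}

/-- A factorization `S = Φ H Ψᵀ` with orthonormal columns in `Φ` and `Ψ`, and a symmetric `H` with
spectrum in `[σd, σ₁]`. -/
structure IsThinSVD (S : Matrix (Fin m) (Fin n) ℝ) (Φ : Matrix (Fin m) (Fin d) ℝ)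
    (Ψ : Matrix (Fin n) (Fin d) ℝ) (H : Matrix (Fin d) (Fin d) ℝ) (σ₁ σd : ℝ) : Prop where
  orthoLeft : Φᵀ * Φ = 1
  orthoRight : Ψᵀ * Ψ = 1
  eq_mul : S = Φ * H * Ψᵀ
  symm : Hᵀ = H
  lower : ∀ (k : ℕ) (X : Matrix (Fin d) (Fin k) ℝ), σd * ‖X‖ ^ 2 ≤ ip X (H * X)
  upper : ∀ (k : ℕ) (X : Matrix (Fin d) (Fin k) ℝ), ‖H * X‖ ≤ σ₁ * ‖X‖

lemma IsThinSVD.transpose {S : Matrix (Fin m) (Fin n) ℝ} {Φ : Matrix (Fin m) (Fin d) ℝ}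
    {Ψ : Matrix (Fin n) (Fin d) ℝ} {H : Matrix (Fin d) (Fin d) ℝ} {σ₁ σd : ℝ}
    (h : IsThinSVD S Φ Ψ H σ₁ σd) : IsThinSVD Sᵀ Ψ Φ H σ₁ σd where
  orthoLeft := h.orthoRight
  orthoRight := h.orthoLeft
  eq_mul := by
    rw [h.eq_mul, Matrix.transpose_mul, Matrix.transpose_mul, Matrix.transpose_transpose, h.symm,
      Matrix.mul_assoc]
  symm := h.symm
  lower := h.lower
  upper := h.upper

/-- The component of (the columns of) `U` orthogonal to the columns of `Φ`. -/
def perp (Φ : Matrix (Fin m) (Fin d) ℝ) (U : Matrix (Fin m) (Fin k) ℝ) : Matrix (Fin m) (Fin k) ℝ :=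
  U - Φ * (Φᵀ * U)

lemma perp_mul {l : ℕ} (Φ : Matrix (Fin m) (Fin d) ℝ) (U : Matrix (Fin m) (Fin k) ℝ)
    (X : Matrix (Fin k) (Fin l) ℝ) : perp Φ (U * X) = perp Φ U * X := by
  simp only [perp, Matrix.sub_mul, Matrix.mul_assoc]

lemma perp_add (Φ : Matrix (Fin m) (Fin d) ℝ) (U V : Matrix (Fin m) (Fin k) ℝ) :
    perp Φ (U + V) = perp Φ U + perp Φ V := by
  simp only [perp, Matrix.mul_add]; abel

lemma perp_sub (Φ : Matrix (Fin m) (Fin d) ℝ) (U V : Matrix (Fin m) (Fin k) ℝ) :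
    perp Φ (U - V) = perp Φ U - perp Φ V := by
  simp only [perp, Matrix.mul_sub]; abel

lemma perp_smul (Φ : Matrix (Fin m) (Fin d) ℝ) (c : ℝ) (U : Matrix (Fin m) (Fin k) ℝ) :
    perp Φ (c • U) = c • perp Φ U := by
  simp only [perp, Matrix.mul_smul, smul_sub]

lemma perp_self {Φ : Matrix (Fin m) (Fin d) ℝ} (hΦ : Φᵀ * Φ = 1) : perp Φ Φ = 0 := by
  simp [perp, hΦ]

lemma gram_eq_add_perp {Φ : Matrix (Fin m) (Fin d) ℝ} (hΦ : Φᵀ * Φ = 1)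
    (U : Matrix (Fin m) (Fin k) ℝ) :
    Uᵀ * U = (Φᵀ * U)ᵀ * (Φᵀ * U) + (perp Φ U)ᵀ * perp Φ U := by
  have h : Φᵀ * (Φ * (Φᵀ * U)) = Φᵀ * U := by rw [← Matrix.mul_assoc, hΦ, Matrix.one_mul]
  simp only [perp, Matrix.transpose_sub, Matrix.transpose_mul, Matrix.transpose_transpose,
    Matrix.sub_mul, Matrix.mul_sub, Matrix.mul_assoc, h]
  abel

lemma norm_sq_eq_add_perp {Φ : Matrix (Fin m) (Fin d) ℝ} (hΦ : Φᵀ * Φ = 1)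
    (U : Matrix (Fin m) (Fin k) ℝ) : ‖U‖ ^ 2 = ‖Φᵀ * U‖ ^ 2 + ‖perp Φ U‖ ^ 2 := by
  simp only [norm_sq_eq_ip, ip_eq_trace]
  rw [gram_eq_add_perp hΦ U, Matrix.trace_add]

lemma norm_proj_le {Φ : Matrix (Fin m) (Fin d) ℝ} (hΦ : Φᵀ * Φ = 1)
    (U : Matrix (Fin m) (Fin k) ℝ) : ‖Φᵀ * U‖ ≤ ‖U‖ :=
  le_of_sq_le_sq (by nlinarith [norm_sq_eq_add_perp hΦ U, sq_nonneg ‖perp Φ U‖]) (norm_nonneg _)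

lemma norm_perp_le {Φ : Matrix (Fin m) (Fin d) ℝ} (hΦ : Φᵀ * Φ = 1)
    (U : Matrix (Fin m) (Fin k) ℝ) : ‖perp Φ U‖ ≤ ‖U‖ :=
  le_of_sq_le_sq (by nlinarith [norm_sq_eq_add_perp hΦ U, sq_nonneg ‖Φᵀ * U‖]) (norm_nonneg _)

lemma IsThinSVD.perp_eq_zero {S : Matrix (Fin m) (Fin n) ℝ} {Φ : Matrix (Fin m) (Fin d) ℝ}
    {Ψ : Matrix (Fin n) (Fin d) ℝ} {H : Matrix (Fin d) (Fin d) ℝ} {σ₁ σd : ℝ}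
    (h : IsThinSVD S Φ Ψ H σ₁ σd) : perp Φ S = 0 := by
  rw [h.eq_mul, perp_mul, perp_mul, perp_self h.orthoLeft, Matrix.zero_mul, Matrix.zero_mul]

/-- `S` has no component orthogonal to `Φ`, so only the damping term `-U VᵀV` acts on this part. -/
lemma IsThinSVD.perp_step {S : Matrix (Fin m) (Fin n) ℝ} {Φ : Matrix (Fin m) (Fin d) ℝ}
    {Ψ : Matrix (Fin n) (Fin d) ℝ} {H : Matrix (Fin d) (Fin d) ℝ} {σ₁ σd : ℝ}
    (h : IsThinSVD S Φ Ψ H σ₁ σd) (η : ℝ) (U : Matrix (Fin m) (Fin k) ℝ)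
    (V : Matrix (Fin n) (Fin k) ℝ) :
    perp Φ (U + η • ((S - U * Vᵀ) * V)) = perp Φ U - η • (perp Φ U * (Vᵀ * V)) := by
  rw [perp_add, perp_smul, perp_mul, perp_sub, h.perp_eq_zero, perp_mul, zero_sub,
    Matrix.neg_mul, smul_neg, ← sub_eq_add_neg, Matrix.mul_assoc]

lemma IsThinSVD.proj_step {S : Matrix (Fin m) (Fin n) ℝ} {Φ : Matrix (Fin m) (Fin d) ℝ}
    {Ψ : Matrix (Fin n) (Fin d) ℝ} {H : Matrix (Fin d) (Fin d) ℝ} {σ₁ σd : ℝ}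
    (h : IsThinSVD S Φ Ψ H σ₁ σd) (η : ℝ) (U : Matrix (Fin m) (Fin k) ℝ)
    (V : Matrix (Fin n) (Fin k) ℝ) :
    Φᵀ * (U + η • ((S - U * Vᵀ) * V)) = Φᵀ * U + η • (H * (Ψᵀ * V) - Φᵀ * U * (Vᵀ * V)) := by
  have h1 : Φᵀ * (Φ * (H * (Ψᵀ * V))) = H * (Ψᵀ * V) := by
    rw [← Matrix.mul_assoc, h.orthoLeft, Matrix.one_mul]
  rw [Matrix.mul_add, Matrix.mul_smul, Matrix.sub_mul, Matrix.mul_sub, h.eq_mul]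
  simp only [Matrix.mul_assoc, h1]

/-- The first-order gain is `2η ‖J Vᵀ‖²`, and the second-order term costs at most half of it. The
gain is written with `V * Jᵀ` so that a lower bound on the singular values of `V` turns it into
contraction of `J`. -/
lemma norm_sub_mul_gram_sq_le (J : Matrix (Fin m) (Fin k) ℝ) (V : Matrix (Fin n) (Fin k) ℝ) {η : ℝ}
    (hη : 0 < η) (hV : η * ‖V‖ ^ 2 ≤ 1) :
    ‖J - η • (J * (Vᵀ * V))‖ ^ 2 ≤ ‖J‖ ^ 2 - η * ‖V * Jᵀ‖ ^ 2 := by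
  have h0 : ‖V * Jᵀ‖ = ‖J * Vᵀ‖ := by
    rw [← Matrix.frobenius_norm_transpose, Matrix.transpose_mul, Matrix.transpose_transpose]
  have h1 : ip J (J * (Vᵀ * V)) = ‖J * Vᵀ‖ ^ 2 := by
    rw [ip_comm, ← Matrix.mul_assoc, ip_mul_right, norm_sq_eq_ip]
  have h2 : ‖J * (Vᵀ * V)‖ ≤ ‖J * Vᵀ‖ * ‖V‖ := by
    rw [← Matrix.mul_assoc]; exact Matrix.frobenius_norm_mul _ _
  have h3 : ‖J * (Vᵀ * V)‖ ^ 2 ≤ ‖J * Vᵀ‖ ^ 2 * ‖V‖ ^ 2 := by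
    rw [← mul_pow]; gcongr
  rw [norm_sub_sq', ip_smul_right, h1, norm_smul, mul_pow, Real.norm_of_nonneg hη.le, h0]
  have h4 : η ^ 2 * ‖J * (Vᵀ * V)‖ ^ 2 ≤ η * ‖J * Vᵀ‖ ^ 2 := by
    calc _ ≤ η ^ 2 * (‖J * Vᵀ‖ ^ 2 * ‖V‖ ^ 2) := by gcongr
      _ = η * ‖J * Vᵀ‖ ^ 2 * (η * ‖V‖ ^ 2) := by ring
      _ ≤ η * ‖J * Vᵀ‖ ^ 2 * 1 := by gcongr
      _ = _ := mul_one _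
  linarith

/-- `A - η A AᵀA` has singular values at least `s (1 - 2 η s²)` if those of `A` are at least `s`. -/
lemma BelowBy.sub_cubic {A : Matrix (Fin m) (Fin n) ℝ} {s η : ℝ} (h : BelowBy A s) (hs : 0 ≤ s)
    (hη : 0 < η) (hA : 4 * (η * ‖A‖ ^ 2) ≤ 1) (hηs : 12 * (η * s ^ 2) ≤ 1) :
    BelowBy (A - η • (A * (Aᵀ * A))) (s * (1 - 2 * (η * s ^ 2))) := by
  intro k X
  have hsq : ∀ Z : Matrix (Fin n) (Fin k) ℝ, s ^ 2 * ‖Z‖ ^ 2 ≤ ‖A * Z‖ ^ 2 := fun Z => by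
    rw [← mul_pow]; exact pow_le_pow_left₀ (by positivity) (h k Z) 2
  have hip : ∀ Z W : Matrix (Fin n) (Fin k) ℝ, ip Z (Aᵀ * A * W) = ip (A * Z) (A * W) :=
    fun Z W => by rw [Matrix.mul_assoc, ip_mul_left]
  set Q := Aᵀ * A with hQ
  set Y := Q * X - s ^ 2 • X with hY
  have hw : ip X Y = ‖A * X‖ ^ 2 - s ^ 2 * ‖X‖ ^ 2 := by
    rw [hY, ip_sub_right, ip_smul_right, hip, norm_sq_eq_ip, norm_sq_eq_ip]
  have hQX : ‖Q * X‖ ^ 2 = ‖Y‖ ^ 2 + 2 * s ^ 2 * ip X Y + s ^ 4 * ‖X‖ ^ 2 := by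
    have : Q * X = Y + s ^ 2 • X := by rw [hY]; abel
    rw [this, norm_add_sq', ip_smul_right, ip_comm Y X, norm_smul, mul_pow,
      Real.norm_of_nonneg (by positivity)]
    ring
  -- In operator form, `Q - s² ≥ 3η (Q - s²)²`. It follows without diagonalizing, by testing `Q ≥
  -- s²` on the vector `X - 2ηY`.
  have hpsd : 3 * (η * ‖Y‖ ^ 2) ≤ ip X Y := by
    have h1 := hsq (X - (2 * η) • Y)
    have h2 : ip (A * X) (A * Y) = ip X Y * s ^ 2 + ‖Y‖ ^ 2 := by
      have : Aᵀ * (A * X) = Y + s ^ 2 • X := by rw [hY, ← Matrix.mul_assoc]; abel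
      rw [ip_comm, ip_mul_left, this, ip_add_right, ip_smul_right, ip_comm Y X, norm_sq_eq_ip]
      ring
    have h3 : ‖A * (X - (2 * η) • Y)‖ ^ 2
        = ‖A * X‖ ^ 2 - 4 * η * (ip X Y * s ^ 2 + ‖Y‖ ^ 2) + 4 * η ^ 2 * ‖A * Y‖ ^ 2 := by
      rw [Matrix.mul_sub, Matrix.mul_smul, norm_sub_sq', ip_smul_right, h2, norm_smul, mul_pow,
        Real.norm_of_nonneg (by positivity)]
      ring
    have h4 : ‖X - (2 * η) • Y‖ ^ 2 = ‖X‖ ^ 2 - 4 * η * ip X Y + 4 * η ^ 2 * ‖Y‖ ^ 2 := by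
      rw [norm_sub_sq', ip_smul_right, norm_smul, mul_pow, Real.norm_of_nonneg (by positivity)]
      ring
    have h5 : 4 * η ^ 2 * ‖A * Y‖ ^ 2 ≤ η * ‖Y‖ ^ 2 := by
      have := Matrix.frobenius_norm_mul A Y
      calc 4 * η ^ 2 * ‖A * Y‖ ^ 2 ≤ 4 * η ^ 2 * (‖A‖ * ‖Y‖) ^ 2 := by gcongr
        _ = (4 * (η * ‖A‖ ^ 2)) * (η * ‖Y‖ ^ 2) := by ring
        _ ≤ 1 * (η * ‖Y‖ ^ 2) := by gcongr
        _ = _ := one_mul _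
    have h6 : 0 ≤ s ^ 2 * (4 * η ^ 2 * ‖Y‖ ^ 2) := by positivity
    rw [h3, h4] at h1
    nlinarith
  have hw0 : 0 ≤ ip X Y := le_trans (by positivity) hpsd
  have h1 : ip (A * X) (A * Q * X) = ‖Q * X‖ ^ 2 := by
    rw [ip_comm, Matrix.mul_assoc, ip_mul_left, ← Matrix.mul_assoc, norm_sq_eq_ip]
  -- With `w = ip X Y`, discarding the square of the cubic term leaves `w + s²‖X‖² - 2η‖QX‖²`. Here
  -- `2η‖Y‖²` costs at most `2w/3` by `hpsd` and `4ηs²w` at most `w/3`, which uses up `w` exactly.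
  have h2 : (s * (1 - 2 * (η * s ^ 2)) * ‖X‖) ^ 2 ≤ ‖(A - η • (A * Q)) * X‖ ^ 2 := by
    rw [Matrix.sub_mul, Matrix.smul_mul, norm_sub_sq', ip_smul_right, h1]
    have h3 : 12 * (η * s ^ 2) * ip X Y ≤ 1 * ip X Y := by gcongr
    have h4 := sq_nonneg ‖η • (A * Q * X)‖
    have h5 : (1 - 2 * (η * s ^ 2)) ^ 2 ≤ 1 - 2 * (η * s ^ 2) := by
      have : 0 ≤ η * s ^ 2 := by positivity
      nlinarith
    have h6 : (s * (1 - 2 * (η * s ^ 2)) * ‖X‖) ^ 2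
        ≤ s ^ 2 * ‖X‖ ^ 2 * (1 - 2 * (η * s ^ 2)) := by
      calc _ = s ^ 2 * ‖X‖ ^ 2 * (1 - 2 * (η * s ^ 2)) ^ 2 := by ring
        _ ≤ _ := by gcongr
    nlinarith
  exact le_of_sq_le_sq h2 (norm_nonneg _)

end Components

end MatFac

namespace MatFac

open scoped Matrix.Norms.Frobenius

/-! ### The dynamics of the half sum and half difference. -/

section Dynamics

variable {m n d : ℕ}

/-- The half sum of the two factors in singular coordinates. -/
def halfSum (Φ : Matrix (Fin m) (Fin d) ℝ) (Ψ : Matrix (Fin n) (Fin d) ℝ)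
    (W : Matrix (Fin m) (Fin d) ℝ × Matrix (Fin n) (Fin d) ℝ) : Matrix (Fin d) (Fin d) ℝ :=
  (1 / 2 : ℝ) • (Φᵀ * W.1 + Ψᵀ * W.2)

/-- The half difference of the two factors in singular coordinates. -/
def halfDiff (Φ : Matrix (Fin m) (Fin d) ℝ) (Ψ : Matrix (Fin n) (Fin d) ℝ)
    (W : Matrix (Fin m) (Fin d) ℝ × Matrix (Fin n) (Fin d) ℝ) : Matrix (Fin d) (Fin d) ℝ :=
  (1 / 2 : ℝ) • (Φᵀ * W.1 - Ψᵀ * W.2)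

/-- The imbalance of the two factors, a conserved quantity of gradient flow. -/
def imbalance (W : Matrix (Fin m) (Fin d) ℝ × Matrix (Fin n) (Fin d) ℝ) :
    Matrix (Fin d) (Fin d) ℝ :=
  W.1ᵀ * W.1 - W.2ᵀ * W.2

/-- The mean of the two Gram matrices. -/
def meanGram (W : Matrix (Fin m) (Fin d) ℝ × Matrix (Fin n) (Fin d) ℝ) :
    Matrix (Fin d) (Fin d) ℝ :=
  (1 / 2 : ℝ) • (W.1ᵀ * W.1 + W.2ᵀ * W.2)

variable {S : Matrix (Fin m) (Fin n) ℝ} {Φ : Matrix (Fin m) (Fin d) ℝ}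
  {Ψ : Matrix (Fin n) (Fin d) ℝ} {H : Matrix (Fin d) (Fin d) ℝ} {σ₁ σd : ℝ}

lemma gdStep_snd (S : Matrix (Fin m) (Fin n) ℝ) (η : ℝ)
    (W : Matrix (Fin m) (Fin d) ℝ × Matrix (Fin n) (Fin d) ℝ) :
    (gdStep S η W).2 = W.2 + η • ((Sᵀ - W.2 * W.1ᵀ) * W.1) := by
  simp [gdStep, Matrix.transpose_sub, Matrix.transpose_mul]

lemma halfSum_add_halfDiff (Φ : Matrix (Fin m) (Fin d) ℝ) (Ψ : Matrix (Fin n) (Fin d) ℝ)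
    (W : Matrix (Fin m) (Fin d) ℝ × Matrix (Fin n) (Fin d) ℝ) :
    halfSum Φ Ψ W + halfDiff Φ Ψ W = Φᵀ * W.1 := by
  simp only [halfSum, halfDiff]; module

lemma halfSum_sub_halfDiff (Φ : Matrix (Fin m) (Fin d) ℝ) (Ψ : Matrix (Fin n) (Fin d) ℝ)
    (W : Matrix (Fin m) (Fin d) ℝ × Matrix (Fin n) (Fin d) ℝ) :
    halfSum Φ Ψ W - halfDiff Φ Ψ W = Ψᵀ * W.2 := by
  simp only [halfSum, halfDiff]; module

lemma meanGram_add_imbalance (W : Matrix (Fin m) (Fin d) ℝ × Matrix (Fin n) (Fin d) ℝ) :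
    W.1ᵀ * W.1 = meanGram W + (1 / 2 : ℝ) • imbalance W := by
  simp only [meanGram, imbalance]; module

lemma meanGram_sub_imbalance (W : Matrix (Fin m) (Fin d) ℝ × Matrix (Fin n) (Fin d) ℝ) :
    W.2ᵀ * W.2 = meanGram W - (1 / 2 : ℝ) • imbalance W := by
  simp only [meanGram, imbalance]; module

/-- `H` exchanges `Φᵀ U` and `Ψᵀ V`, so it acts with sign `+` on their half sum and `-` on their
half difference. Writing the Gram matrices as mean `±` half the imbalance isolates the coupling of
the two. -/
lemma halfSum_gdStep (h : IsThinSVD S Φ Ψ H σ₁ σd) (η : ℝ)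
    (W : Matrix (Fin m) (Fin d) ℝ × Matrix (Fin n) (Fin d) ℝ) :
    halfSum Φ Ψ (gdStep S η W) = halfSum Φ Ψ W + η • (H * halfSum Φ Ψ W
      - halfSum Φ Ψ W * meanGram W + (1 / 2 : ℝ) • (halfDiff Φ Ψ W * imbalance W)) := by
  have h1 : halfSum Φ Ψ (gdStep S η W) = (1 / 2 : ℝ) •
      (Φᵀ * (W.1 + η • ((S - W.1 * W.2ᵀ) * W.2))
        + Ψᵀ * (W.2 + η • ((Sᵀ - W.2 * W.1ᵀ) * W.1))) := by
    rw [← gdStep_snd]; rfl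
  rw [h1, h.proj_step, h.transpose.proj_step, meanGram_add_imbalance, meanGram_sub_imbalance,
    ← halfSum_add_halfDiff Φ Ψ W, ← halfSum_sub_halfDiff Φ Ψ W]
  simp only [Matrix.mul_add, Matrix.add_mul, Matrix.mul_sub, Matrix.sub_mul, Matrix.mul_smul]
  module

lemma halfDiff_gdStep (h : IsThinSVD S Φ Ψ H σ₁ σd) (η : ℝ)
    (W : Matrix (Fin m) (Fin d) ℝ × Matrix (Fin n) (Fin d) ℝ) :
    halfDiff Φ Ψ (gdStep S η W) = (halfDiff Φ Ψ W - η • (H * halfDiff Φ Ψ W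
      + halfDiff Φ Ψ W * meanGram W)) + (η / 2) • (halfSum Φ Ψ W * imbalance W) := by
  have h1 : halfDiff Φ Ψ (gdStep S η W) = (1 / 2 : ℝ) •
      (Φᵀ * (W.1 + η • ((S - W.1 * W.2ᵀ) * W.2))
        - Ψᵀ * (W.2 + η • ((Sᵀ - W.2 * W.1ᵀ) * W.1))) := by
    rw [← gdStep_snd]; rfl
  rw [h1, h.proj_step, h.transpose.proj_step, meanGram_add_imbalance, meanGram_sub_imbalance,
    ← halfSum_add_halfDiff Φ Ψ W, ← halfSum_sub_halfDiff Φ Ψ W]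
  simp only [Matrix.mul_add, Matrix.add_mul, Matrix.mul_sub, Matrix.sub_mul, Matrix.mul_smul]
  module

lemma ip_mul_meanGram_nonneg (B : Matrix (Fin d) (Fin d) ℝ)
    (W : Matrix (Fin m) (Fin d) ℝ × Matrix (Fin n) (Fin d) ℝ) : 0 ≤ ip B (B * meanGram W) := by
  have key : ∀ (l : ℕ) (V : Matrix (Fin l) (Fin d) ℝ), 0 ≤ ip B (B * (Vᵀ * V)) := fun l V => by
    rw [ip_comm, ← Matrix.mul_assoc, ip_mul_right, ← norm_sq_eq_ip]; positivity
  rw [meanGram, Matrix.mul_smul, ip_smul_right, Matrix.mul_add, ip_add_right]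
  have := key m W.1
  have := key n W.2
  positivity

lemma norm_meanGram_le {W : Matrix (Fin m) (Fin d) ℝ × Matrix (Fin n) (Fin d) ℝ} {L : ℝ}
    (hU : ‖W.1‖ ^ 2 ≤ L) (hV : ‖W.2‖ ^ 2 ≤ L) : ‖meanGram W‖ ≤ L := by
  rw [meanGram, norm_smul, Real.norm_of_nonneg (by norm_num)]
  have h1 := norm_transpose_mul_self_le W.1
  have h2 := norm_transpose_mul_self_le W.2
  have h3 := norm_add_le (W.1ᵀ * W.1) (W.2ᵀ * W.2)
  linarith

lemma norm_halfSum_le (h : IsThinSVD S Φ Ψ H σ₁ σd)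
    {W : Matrix (Fin m) (Fin d) ℝ × Matrix (Fin n) (Fin d) ℝ} {l : ℝ}
    (hU : ‖W.1‖ ≤ l) (hV : ‖W.2‖ ≤ l) : ‖halfSum Φ Ψ W‖ ≤ l := by
  rw [halfSum, norm_smul, Real.norm_of_nonneg (by norm_num)]
  have h1 := norm_proj_le h.orthoLeft W.1
  have h2 := norm_proj_le h.orthoRight W.2
  have h3 := norm_add_le (Φᵀ * W.1) (Ψᵀ * W.2)
  linarith

lemma norm_halfDiff_le (h : IsThinSVD S Φ Ψ H σ₁ σd)
    {W : Matrix (Fin m) (Fin d) ℝ × Matrix (Fin n) (Fin d) ℝ} {l : ℝ}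
    (hU : ‖W.1‖ ≤ l) (hV : ‖W.2‖ ≤ l) : ‖halfDiff Φ Ψ W‖ ≤ l := by
  rw [halfDiff, norm_smul, Real.norm_of_nonneg (by norm_num)]
  have h1 := norm_proj_le h.orthoLeft W.1
  have h2 := norm_proj_le h.orthoRight W.2
  have h3 := norm_sub_le (Φᵀ * W.1) (Ψᵀ * W.2)
  linarith

/-- The half difference contracts, up to a forcing term from the imbalance. -/
lemma norm_halfDiff_gdStep_le (h : IsThinSVD S Φ Ψ H σ₁ σd) {η L : ℝ} (hη : 0 < η)
    (hσd : 0 < σd)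
    {W : Matrix (Fin m) (Fin d) ℝ × Matrix (Fin n) (Fin d) ℝ} (hN : ‖meanGram W‖ ≤ L)
    (hηL : η * (σ₁ + L) ^ 2 ≤ σd) (hησ : η * σd ≤ 1) :
    ‖halfDiff Φ Ψ (gdStep S η W)‖ ≤ (1 - η * σd / 2) * ‖halfDiff Φ Ψ W‖
      + η / 2 * (‖halfSum Φ Ψ W‖ * ‖imbalance W‖) := by
  rw [halfDiff_gdStep h]
  set B := halfDiff Φ Ψ W
  refine (norm_add_le _ _).trans ?_
  -- The term `-2ησd‖B‖²` from `H` loses at most half to second order, and `1 - ησd ≤ (1 - ησd/2)²`.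
  have h1 : ‖B - η • (H * B + B * meanGram W)‖ ^ 2 ≤ ((1 - η * σd / 2) * ‖B‖) ^ 2 := by
    rw [norm_sub_sq', ip_smul_right, ip_add_right, norm_smul, mul_pow, Real.norm_of_nonneg hη.le]
    have e1 := h.lower d B
    have e2 := ip_mul_meanGram_nonneg B W
    have e3 : ‖H * B + B * meanGram W‖ ≤ (σ₁ + L) * ‖B‖ := by
      have f1 := h.upper d B
      have f2 := Matrix.frobenius_norm_mul B (meanGram W)
      have f3 := mul_le_mul_of_nonneg_left hN (norm_nonneg B)
      have f4 := norm_add_le (H * B) (B * meanGram W)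
      linarith
    have e4 : η ^ 2 * ‖H * B + B * meanGram W‖ ^ 2 ≤ η * σd * ‖B‖ ^ 2 := by
      calc _ ≤ η ^ 2 * ((σ₁ + L) * ‖B‖) ^ 2 := by gcongr
        _ = η * (η * (σ₁ + L) ^ 2) * ‖B‖ ^ 2 := by ring
        _ ≤ _ := by gcongr
    have e5 := mul_le_mul_of_nonneg_left e1 hη.le
    have e6 := mul_nonneg hη.le e2
    have e7 : 0 ≤ (η * σd / 2) ^ 2 * ‖B‖ ^ 2 := by positivity
    nlinarith
  have h2 : ‖B - η • (H * B + B * meanGram W)‖ ≤ (1 - η * σd / 2) * ‖B‖ :=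
    le_of_sq_le_sq h1 (mul_nonneg (by linarith) (norm_nonneg _))
  have h3 : ‖(η / 2) • (halfSum Φ Ψ W * imbalance W)‖
      ≤ η / 2 * (‖halfSum Φ Ψ W‖ * ‖imbalance W‖) := by
    rw [norm_smul, Real.norm_of_nonneg (by positivity)]
    gcongr
    exact Matrix.frobenius_norm_mul _ _
  exact add_le_add h2 h3

/-- The part of the mean Gram matrix that does not come from the half sum. -/
def gramError (Φ : Matrix (Fin m) (Fin d) ℝ) (Ψ : Matrix (Fin n) (Fin d) ℝ)
    (W : Matrix (Fin m) (Fin d) ℝ × Matrix (Fin n) (Fin d) ℝ) : Matrix (Fin d) (Fin d) ℝ :=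
  (halfDiff Φ Ψ W)ᵀ * halfDiff Φ Ψ W
    + (1 / 2 : ℝ) • ((perp Φ W.1)ᵀ * perp Φ W.1 + (perp Ψ W.2)ᵀ * perp Ψ W.2)

/-- The cross terms of `(A + B)ᵀ(A + B)` and `(A - B)ᵀ(A - B)` cancel in the mean, so the damping of
`A` is `AᵀA` plus an error quadratic in the small parts. -/
lemma meanGram_eq (h : IsThinSVD S Φ Ψ H σ₁ σd)
    (W : Matrix (Fin m) (Fin d) ℝ × Matrix (Fin n) (Fin d) ℝ) :
    meanGram W = (halfSum Φ Ψ W)ᵀ * halfSum Φ Ψ W + gramError Φ Ψ W := by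
  rw [meanGram, gram_eq_add_perp h.orthoLeft, gram_eq_add_perp h.orthoRight,
    ← halfSum_add_halfDiff Φ Ψ W, ← halfSum_sub_halfDiff Φ Ψ W, gramError]
  simp only [Matrix.transpose_add, Matrix.transpose_sub, Matrix.mul_add, Matrix.add_mul,
    Matrix.mul_sub, Matrix.sub_mul]
  module

lemma norm_gramError_le (W : Matrix (Fin m) (Fin d) ℝ × Matrix (Fin n) (Fin d) ℝ) :
    ‖gramError Φ Ψ W‖ ≤ ‖halfDiff Φ Ψ W‖ ^ 2
      + 1 / 2 * (‖perp Φ W.1‖ ^ 2 + ‖perp Ψ W.2‖ ^ 2) := by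
  rw [gramError]
  refine (norm_add_le _ _).trans (add_le_add (norm_transpose_mul_self_le _) ?_)
  rw [norm_smul, Real.norm_of_nonneg (by norm_num)]
  gcongr
  exact (norm_add_le _ _).trans
    (add_le_add (norm_transpose_mul_self_le _) (norm_transpose_mul_self_le _))

/-- Used with `x = ησd`, `u = ηs²`, `v = ηe`: the cubic damping and the Gram error consume at most
half of the growth coming from `H`. -/
lemma one_add_half_le {x u v : ℝ} (hx : 0 ≤ x) (hx1 : x ≤ 1) (hu : 0 ≤ u) (hux : u ≤ x / 16)
    (hv : 0 ≤ v) (hvx : v ≤ x / 16) : 1 + x / 2 ≤ (1 + x) * ((1 - 2 * u) * (1 - v)) := by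
  have h1 : 1 - 3 * x / 16 ≤ (1 - 2 * u) * (1 - v) := by nlinarith [mul_nonneg hu hv]
  have h2 := mul_le_mul_of_nonneg_left h1 (by linarith : 0 ≤ 1 + x)
  nlinarith

/-- Perturbed growth: `A + η (H A - A (AᵀA + E) + F)` has all singular values larger than those of
`A` by a factor `1 + η σd / 4`, as long as the smallest one is at most `√σd / 4`. -/
lemma BelowBy.growth {A E F H : Matrix (Fin d) (Fin d) ℝ} {η s α e ν β σ₁ σd : ℝ} (hη : 0 < η)
    (hσ₁ : 0 ≤ σ₁) (hσd : 0 < σd)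
    (lower : ∀ (k : ℕ) (X : Matrix (Fin d) (Fin k) ℝ), σd * ‖X‖ ^ 2 ≤ ip X (H * X))
    (upper : ∀ (k : ℕ) (X : Matrix (Fin d) (Fin k) ℝ), ‖H * X‖ ≤ σ₁ * ‖X‖)
    (hs : 0 ≤ s) (hA : BelowBy A s) (hsσ : 16 * s ^ 2 ≤ σd)
    (hα : ‖A‖ ≤ α) (he : ‖E‖ ≤ e) (heσ : 16 * e ≤ σd)
    (hν : ‖Aᵀ * A + E‖ ≤ ν) (hβ : ‖F‖ ≤ β)
    (hηα : 4 * (η * α ^ 2) ≤ 1) (hησ : η * σd ≤ 1) (hησ₁ : η * σ₁ ≤ 1)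
    (herr : 2 * η * (α ^ 3 * e) + η * (σ₁ * (α * ν)) + β ≤ σd * s / 4) :
    BelowBy (A + η • (H * A - A * (Aᵀ * A + E) + F)) ((1 + η * σd / 4) * s) := by
  intro k X
  have hα0 : 0 ≤ α := (norm_nonneg _).trans hα
  have he0 : 0 ≤ e := (norm_nonneg _).trans he
  have hcub := hA.sub_cubic hs hη (by nlinarith [pow_le_pow_left₀ (norm_nonneg _) hα 2])
    (by nlinarith)
  obtain ⟨Z, hZ⟩ : ∃ Z, Z = X - η • (E * X) := ⟨_, rfl⟩
  obtain ⟨Y, hY⟩ : ∃ Y, Y = (A - η • (A * (Aᵀ * A))) * Z := ⟨_, rfl⟩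
  obtain ⟨T2, hT2⟩ : ∃ T, T = η ^ 2 • (A * (Aᵀ * A) * (E * X)) := ⟨_, rfl⟩
  obtain ⟨T3, hT3⟩ : ∃ T, T = η • (H * T2) := ⟨_, rfl⟩
  obtain ⟨T4, hT4⟩ : ∃ T, T = η ^ 2 • (H * (A * ((Aᵀ * A + E) * X))) := ⟨_, rfl⟩
  obtain ⟨T5, hT5⟩ : ∃ T, T = η • (F * X) := ⟨_, rfl⟩
  obtain ⟨T1, hT1⟩ : ∃ T, T = Y + η • (H * Y) := ⟨_, rfl⟩
  -- The update is `(1 + ηH)(A - ηAAᵀA)(1 - ηE)`, each factor of which has a direct lower bound, up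
  -- to the `η²` remainders `T2`, `T3`, `T4` and the forcing `T5`.
  have hid : (A + η • (H * A - A * (Aᵀ * A + E) + F)) * X = T1 - (T2 + T3) + T4 + T5 := by
    rw [hT1, hT3, hT2, hT4, hT5, hY, hZ]
    simp only [Matrix.mul_add, Matrix.add_mul, Matrix.mul_sub, Matrix.sub_mul, Matrix.mul_smul,
      Matrix.smul_mul, Matrix.mul_assoc]
    module
  have hZn : (1 - η * e) * ‖X‖ ≤ ‖Z‖ := by
    have e1 : ‖E * X‖ ≤ e * ‖X‖ := (Matrix.frobenius_norm_mul _ _).trans (by gcongr)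
    have e2 : ‖X‖ ≤ ‖Z‖ + ‖η • (E * X)‖ := by
      have : X = Z + η • (E * X) := by rw [hZ]; abel
      calc ‖X‖ = ‖Z + η • (E * X)‖ := by rw [← this]
        _ ≤ _ := norm_add_le _ _
    rw [norm_smul, Real.norm_of_nonneg hη.le] at e2
    have e3 := mul_le_mul_of_nonneg_left e1 hη.le
    linarith
  have hYn : s * (1 - 2 * (η * s ^ 2)) * ((1 - η * e) * ‖X‖) ≤ ‖Y‖ := by
    rw [hY]
    refine le_trans ?_ (hcub k Z)
    exact mul_le_mul_of_nonneg_left hZn (mul_nonneg hs (by nlinarith))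
  have hHY : (1 + η * σd) * ‖Y‖ ≤ ‖T1‖ := by
    have e1 : ip Y (Y + η • (H * Y)) = ‖Y‖ ^ 2 + η * ip Y (H * Y) := by
      rw [ip_add_right, ip_smul_right, norm_sq_eq_ip]
    have e2 := ip_le Y (Y + η • (H * Y))
    have e3 := mul_le_mul_of_nonneg_left (lower k Y) hη.le
    rcases (norm_nonneg Y).eq_or_lt with h0 | h0
    · rw [← h0, mul_zero]; exact norm_nonneg _
    · rw [hT1]
      refine le_of_mul_le_mul_left ?_ h0
      nlinarith
  have hr2 : ‖T2‖ ≤ η ^ 2 * (α ^ 3 * e * ‖X‖) := by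
    rw [hT2, norm_smul, Real.norm_of_nonneg (by positivity)]
    refine mul_le_mul_of_nonneg_left ?_ (by positivity)
    have e1 : ‖A * (Aᵀ * A)‖ ≤ α * α ^ 2 :=
      (Matrix.frobenius_norm_mul _ _).trans (mul_le_mul hα ((norm_transpose_mul_self_le A).trans
        (pow_le_pow_left₀ (norm_nonneg _) hα 2)) (norm_nonneg _) hα0)
    have e2 : ‖E * X‖ ≤ e * ‖X‖ :=
      (Matrix.frobenius_norm_mul _ _).trans (mul_le_mul_of_nonneg_right he (norm_nonneg _))
    refine (Matrix.frobenius_norm_mul _ _).trans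
      ((mul_le_mul e1 e2 (norm_nonneg _) (by positivity)).trans (le_of_eq (by ring)))
  have hr3 : ‖T3‖ ≤ η ^ 2 * (α ^ 3 * e * ‖X‖) := by
    rw [hT3, norm_smul, Real.norm_of_nonneg hη.le]
    have e1 := mul_le_mul_of_nonneg_left (upper k T2) hη.le
    have e2 := mul_le_mul_of_nonneg_right hησ₁ (norm_nonneg T2)
    linarith
  have hr4 : ‖T4‖ ≤ η ^ 2 * (σ₁ * (α * ν) * ‖X‖) := by
    rw [hT4, norm_smul, Real.norm_of_nonneg (by positivity)]
    refine mul_le_mul_of_nonneg_left ?_ (by positivity)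
    have e1 : ‖(Aᵀ * A + E) * X‖ ≤ ν * ‖X‖ :=
      (Matrix.frobenius_norm_mul _ _).trans (mul_le_mul_of_nonneg_right hν (norm_nonneg _))
    have e2 : ‖A * ((Aᵀ * A + E) * X)‖ ≤ α * (ν * ‖X‖) :=
      (Matrix.frobenius_norm_mul _ _).trans (mul_le_mul hα e1 (norm_nonneg _) hα0)
    have e3 := mul_le_mul_of_nonneg_left e2 hσ₁
    linarith [upper k (A * ((Aᵀ * A + E) * X))]
  have hr5 : ‖T5‖ ≤ η * (β * ‖X‖) := by
    rw [hT5, norm_smul, Real.norm_of_nonneg hη.le]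
    exact mul_le_mul_of_nonneg_left ((Matrix.frobenius_norm_mul _ _).trans
      (mul_le_mul_of_nonneg_right hβ (norm_nonneg _))) hη.le
  rw [hid]
  have htri : ‖T1‖ ≤ ‖T1 - (T2 + T3) + T4 + T5‖ + ‖T2‖ + ‖T3‖ + ‖T4‖ + ‖T5‖ := by
    have : T1 = (T1 - (T2 + T3) + T4 + T5) + T2 + T3 - T4 - T5 := by abel
    calc ‖T1‖ = ‖(T1 - (T2 + T3) + T4 + T5) + T2 + T3 - T4 - T5‖ := by rw [← this]
      _ ≤ _ := by
        refine (norm_sub_le _ _).trans (add_le_add_left ?_ _)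
        refine (norm_sub_le _ _).trans (add_le_add_left ?_ _)
        refine (norm_add_le _ _).trans (add_le_add_left ?_ _)
        exact norm_add_le _ _
  have herr' : 2 * (η ^ 2 * (α ^ 3 * e * ‖X‖)) + η ^ 2 * (σ₁ * (α * ν) * ‖X‖)
      + η * (β * ‖X‖) ≤ η * σd / 4 * (s * ‖X‖) := by
    have := mul_le_mul_of_nonneg_left herr (mul_nonneg hη.le (norm_nonneg X))
    linarith
  -- The product form yields growth `1 + ησd/2`; the remainders were budgeted at `ησd/4`.
  have hgrow : (1 + η * σd / 2) * (s * ‖X‖)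
      ≤ (1 + η * σd) * (s * (1 - 2 * (η * s ^ 2)) * ((1 - η * e) * ‖X‖)) := by
    have hx0 : 0 < η * σd := by positivity
    have e1 : η * e ≤ η * σd / 16 := by nlinarith
    have e2 : η * s ^ 2 ≤ η * σd / 16 := by nlinarith
    have e3 : 0 ≤ η * s ^ 2 := by positivity
    have e4 : 0 ≤ η * e := by positivity
    have e5 := one_add_half_le hx0.le hησ e3 e2 e4 e1
    have := mul_le_mul_of_nonneg_right e5 (mul_nonneg hs (norm_nonneg X))
    linarith
  have hfin := mul_le_mul_of_nonneg_left hYn (by positivity : 0 ≤ 1 + η * σd)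
  have hexp : (1 + η * σd / 4) * s * ‖X‖ = (1 + η * σd / 2) * (s * ‖X‖) - η * σd / 4 * (s * ‖X‖) := by
    ring
  rw [hexp]
  linarith

/-- As long as its smallest singular value is at most `√σd / 4`, the half sum grows geometrically
in every direction. -/
lemma BelowBy.halfSum_gdStep (h : IsThinSVD S Φ Ψ H σ₁ σd) {η s α e ν β : ℝ} (hη : 0 < η)
    (hσ₁ : 0 ≤ σ₁) (hσd : 0 < σd) {W : Matrix (Fin m) (Fin d) ℝ × Matrix (Fin n) (Fin d) ℝ}
    (hs : 0 ≤ s) (hA : BelowBy (halfSum Φ Ψ W) s) (hsσ : 16 * s ^ 2 ≤ σd)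
    (hα : ‖halfSum Φ Ψ W‖ ≤ α) (he : ‖gramError Φ Ψ W‖ ≤ e) (heσ : 16 * e ≤ σd)
    (hν : ‖meanGram W‖ ≤ ν) (hβ : ‖halfDiff Φ Ψ W‖ * ‖imbalance W‖ ≤ β)
    (hηα : 4 * (η * α ^ 2) ≤ 1) (hησ : η * σd ≤ 1) (hησ₁ : η * σ₁ ≤ 1)
    (herr : 2 * η * (α ^ 3 * e) + η * (σ₁ * (α * ν)) + β / 2 ≤ σd * s / 4) :
    BelowBy (halfSum Φ Ψ (gdStep S η W)) ((1 + η * σd / 4) * s) := by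
  rw [MatFac.halfSum_gdStep h, meanGram_eq h]
  rw [meanGram_eq h] at hν
  refine hA.growth hη hσ₁ hσd h.lower h.upper hs hsσ hα he heσ hν (β := β / 2) ?_ hηα hησ hησ₁ herr
  rw [norm_smul, Real.norm_of_nonneg (by norm_num)]
  linarith [(Matrix.frobenius_norm_mul (halfDiff Φ Ψ W) (imbalance W)).trans hβ]

/-- Gradient domination: the residual is controlled by the gradient, up to the second-order
quantity `‖J‖² ‖K‖²`, `J` and `K` being the parts of the factors outside the singular spaces. -/
lemma gradient_dominated (h : IsThinSVD S Φ Ψ H σ₁ σd) {s : ℝ} (hs : 0 < s)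
    (U : Matrix (Fin m) (Fin d) ℝ) (V : Matrix (Fin n) (Fin d) ℝ)
    (hU : BelowBy (Φᵀ * U) s) (hV : BelowBy (Ψᵀ * V) s)
    (hJK : 4 * (‖perp Φ U‖ ^ 2 + ‖perp Ψ V‖ ^ 2) ≤ s ^ 2) :
    s ^ 2 / 4 * ‖S - U * Vᵀ‖ ^ 2 - s ^ 2 / 2 * (‖perp Φ U‖ ^ 2 * ‖perp Ψ V‖ ^ 2)
      ≤ ‖(S - U * Vᵀ) * V‖ ^ 2 + ‖(S - U * Vᵀ)ᵀ * U‖ ^ 2 := by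
  -- Split `V` along and orthogonal to `Ψ`. Right multiplication by the square matrix `Ψᵀ V` needs
  -- the singular value bound for its transpose.
  have half : ∀ {p q : ℕ} (P : Matrix (Fin p) (Fin q) ℝ) (Ψ V : Matrix (Fin q) (Fin d) ℝ),
      BelowBy (Ψᵀ * V) s →
      s ^ 2 / 2 * ‖P * Ψ‖ ^ 2 - ‖P‖ ^ 2 * ‖perp Ψ V‖ ^ 2 ≤ ‖P * V‖ ^ 2 := by
    intro p q P Ψ V hV
    have e1 : P * V = P * Ψ * (Ψᵀ * V) + P * perp Ψ V := by
      rw [perp, Matrix.mul_sub, Matrix.mul_assoc]; abel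
    have e2 : s * ‖P * Ψ‖ ≤ ‖P * Ψ * (Ψᵀ * V)‖ := by
      have := hV.transpose hs p (P * Ψ)ᵀ
      rwa [← Matrix.transpose_mul, Matrix.frobenius_norm_transpose,
        Matrix.frobenius_norm_transpose] at this
    have e3 : ‖P * perp Ψ V‖ ^ 2 ≤ ‖P‖ ^ 2 * ‖perp Ψ V‖ ^ 2 := by
      rw [← mul_pow]; gcongr; exact Matrix.frobenius_norm_mul _ _
    have e4 : s ^ 2 * ‖P * Ψ‖ ^ 2 ≤ ‖P * Ψ * (Ψᵀ * V)‖ ^ 2 := by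
      rw [← mul_pow]; gcongr
    have e5 : ‖P * Ψ * (Ψᵀ * V)‖ ≤ ‖P * V‖ + ‖P * perp Ψ V‖ := by
      have : P * Ψ * (Ψᵀ * V) = P * V - P * perp Ψ V := by rw [e1]; abel
      rw [this]; exact norm_sub_le _ _
    have e6 : ‖P * Ψ * (Ψᵀ * V)‖ ^ 2 ≤ (‖P * V‖ + ‖P * perp Ψ V‖) ^ 2 := by gcongr
    nlinarith [sq_nonneg (‖P * V‖ - ‖P * perp Ψ V‖)]
  set P := S - U * Vᵀ with hP
  have h1 := half P Ψ V hV
  have h2 := half Pᵀ Φ U hU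
  have h3 : ‖Pᵀ * Φ‖ = ‖Φᵀ * P‖ := by
    rw [← Matrix.frobenius_norm_transpose, Matrix.transpose_mul, Matrix.transpose_transpose]
  rw [Matrix.frobenius_norm_transpose, h3] at h2
  -- The block of `P` orthogonal to both singular spaces is `-J Kᵀ`, since `S` has no such block. It
  -- is the part that the gradient bound does not see.
  have h4 : ‖P‖ ^ 2 ≤ ‖P * Ψ‖ ^ 2 + ‖Φᵀ * P‖ ^ 2 + ‖perp Φ U‖ ^ 2 * ‖perp Ψ V‖ ^ 2 := by
    have e1 := norm_sq_eq_add_perp h.orthoLeft P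
    have e2 := norm_sq_eq_add_perp h.orthoRight (perp Φ P)ᵀ
    have e3 : ‖Ψᵀ * (perp Φ P)ᵀ‖ ≤ ‖P * Ψ‖ := by
      rw [← Matrix.transpose_mul, Matrix.frobenius_norm_transpose, ← perp_mul]
      exact norm_perp_le h.orthoLeft _
    have e4 : perp Φ P = -(perp Φ U * Vᵀ) := by
      rw [hP, perp_sub, h.perp_eq_zero, perp_mul, zero_sub]
    have e5 : ‖perp Ψ (perp Φ P)ᵀ‖ ≤ ‖perp Φ U‖ * ‖perp Ψ V‖ := by
      have : (perp Φ P)ᵀ = V * (-(perp Φ U))ᵀ := by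
        rw [e4, ← Matrix.neg_mul, Matrix.transpose_mul, Matrix.transpose_transpose]
      rw [this, perp_mul, mul_comm]
      refine (Matrix.frobenius_norm_mul _ _).trans ?_
      rw [Matrix.frobenius_norm_transpose, norm_neg]
    rw [Matrix.frobenius_norm_transpose] at e2
    have e6 := pow_le_pow_left₀ (norm_nonneg _) e3 2
    have e7 := pow_le_pow_left₀ (norm_nonneg _) e5 2
    rw [mul_pow] at e7
    linarith
  have h5 := mul_le_mul_of_nonneg_left hJK (sq_nonneg ‖P‖)
  have h6 := mul_le_mul_of_nonneg_left h4 (sq_nonneg s)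
  nlinarith

end Dynamics

end MatFac

namespace MatFac

open scoped Matrix.Norms.Frobenius

/-! ### Invariants of the trajectory and deterministic convergence. -/

section Convergence

/-- The smallness conditions on the size `r` of the initialization, the smallest singular value `s₀`
of the initial half sum and the step size `η`; `l` bounds the factors along the trajectory. -/
structure SmallParams (d : ℕ) (σ₁ σd η r s₀ l : ℝ) : Prop where
  step_pos : 0 < η
  r_nonneg : 0 ≤ r
  s_pos : 0 < s₀
  σd_pos : 0 < σd
  σd_le : σd ≤ σ₁
  d_pos : 1 ≤ (d : ℝ)
  l_nonneg : 0 ≤ l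
  l_sq : l ^ 2 = 5 * (d * σ₁)
  -- `l_mul_r_le` keeps the half difference below `r`. `r_cube_le` and `step_growth` each cover half
  -- of the error budget `σd s / 4` of the growth step. `step_drift` makes `η` times the squared
  -- residual at most `r²`.
  r_sq_le : 1000 * r ^ 2 ≤ σd
  l_mul_r_le : 3 * (l * r) ≤ σd
  r_cube_le : 12 * r ^ 3 ≤ σd * s₀
  step_growth : 40 * (η * (σ₁ * l ^ 3)) ≤ σd * s₀
  step_drift : 4 * (η * (d * σ₁ ^ 2)) ≤ r ^ 2
  step_smooth : 8 * (η * (l ^ 2) ^ 2) ≤ σd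
  s_sq_le : 16 * s₀ ^ 2 ≤ σd

namespace SmallParams

variable {d : ℕ} {σ₁ σd η r s₀ l : ℝ}

lemma σ₁_pos (h : SmallParams d σ₁ σd η r s₀ l) : 0 < σ₁ := h.σd_pos.trans_le h.σd_le

lemma l_sq_ge (h : SmallParams d σ₁ σd η r s₀ l) : 5 * σ₁ ≤ l ^ 2 := by
  rw [h.l_sq]; nlinarith [h.d_pos, h.σ₁_pos]

lemma step_mul_l_sq (h : SmallParams d σ₁ σd η r s₀ l) : η * l ^ 2 ≤ 1 / 8 := by
  have h1 := h.l_sq_ge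
  have h2 := h.step_smooth
  have h3 : 0 < l ^ 2 := by linarith [h.σ₁_pos]
  refine le_of_mul_le_mul_right ?_ h3
  nlinarith [h.σd_le, h.σd_pos]

lemma step_mul_σ₁ (h : SmallParams d σ₁ σd η r s₀ l) : η * σ₁ ≤ 1 / 8 := by
  nlinarith [h.step_mul_l_sq, h.l_sq_ge, h.step_pos, h.σ₁_pos]

lemma step_mul_σd (h : SmallParams d σ₁ σd η r s₀ l) : η * σd ≤ 1 / 8 := by
  nlinarith [h.step_mul_σ₁, h.σd_le, h.step_pos]

end SmallParams

variable {m n d : ℕ} {S : Matrix (Fin m) (Fin n) ℝ} {Φ : Matrix (Fin m) (Fin d) ℝ}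
  {Ψ : Matrix (Fin n) (Fin d) ℝ} {H : Matrix (Fin d) (Fin d) ℝ} {σ₁ σd η r s₀ l : ℝ}

/-- The invariant of the trajectory that does not involve the growth of the half sum. -/
structure Controlled (S : Matrix (Fin m) (Fin n) ℝ) (Φ : Matrix (Fin m) (Fin d) ℝ)
    (Ψ : Matrix (Fin n) (Fin d) ℝ) (σ₁ η r : ℝ)
    (W : Matrix (Fin m) (Fin d) ℝ × Matrix (Fin n) (Fin d) ℝ) : Prop where
  residual : ‖S - W.1 * W.2ᵀ‖ ^ 2 ≤ 4 * (d * σ₁ ^ 2)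
  drift : ‖imbalance W‖ + η * ‖S - W.1 * W.2ᵀ‖ ^ 2 ≤ 3 * r ^ 2
  left : ‖perp Φ W.1‖ ≤ r
  right : ‖perp Ψ W.2‖ ≤ r
  diff : ‖halfDiff Φ Ψ W‖ ≤ r

lemma Controlled.imbalance_le {W : Matrix (Fin m) (Fin d) ℝ × Matrix (Fin n) (Fin d) ℝ}
    (hη : 0 < η) (hW : Controlled S Φ Ψ σ₁ η r W) : ‖imbalance W‖ ≤ 3 * r ^ 2 := by
  have : 0 ≤ η * ‖S - W.1 * W.2ᵀ‖ ^ 2 := by positivity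
  linarith [hW.drift]

/-- `‖U Vᵀ‖ ≤ 3 √d σ₁` and the imbalance is at most `σ₁`, so `norm_gram_sq_add` bounds each squared
Gram norm by `(1 + 2·9) d σ₁²`. Then `norm_pow_four_le` gives `‖U‖⁴ ≤ 19 d² σ₁² ≤ l⁴`. -/
lemma Controlled.factors_sq_le {W : Matrix (Fin m) (Fin d) ℝ × Matrix (Fin n) (Fin d) ℝ}
    (hp : SmallParams d σ₁ σd η r s₀ l) (hS : ‖S‖ ^ 2 ≤ d * σ₁ ^ 2)
    (hW : Controlled S Φ Ψ σ₁ η r W) : ‖W.1‖ ^ 2 ≤ l ^ 2 ∧ ‖W.2‖ ^ 2 ≤ l ^ 2 := by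
  have hd := hp.d_pos
  have hσ := hp.σ₁_pos
  have h1 : ‖W.1 * W.2ᵀ‖ ^ 2 ≤ 9 * (d * σ₁ ^ 2) := by
    have e1 : W.1 * W.2ᵀ = S - (S - W.1 * W.2ᵀ) := by abel
    have e2 : ‖W.1 * W.2ᵀ‖ ≤ ‖S‖ + ‖S - W.1 * W.2ᵀ‖ := by
      conv_lhs => rw [e1]
      exact norm_sub_le _ _
    have e3 := pow_le_pow_left₀ (norm_nonneg _) e2 2
    nlinarith [sq_nonneg (2 * ‖S‖ - ‖S - W.1 * W.2ᵀ‖), hW.residual]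
  have h2 : ‖imbalance W‖ ^ 2 ≤ d * σ₁ ^ 2 := by
    have e1 : ‖imbalance W‖ ≤ σ₁ := by
      linarith [hW.imbalance_le hp.step_pos, hp.r_sq_le, hp.σd_le, sq_nonneg r]
    have e2 := pow_le_pow_left₀ (norm_nonneg _) e1 2
    nlinarith [sq_nonneg σ₁]
  have h3 := norm_gram_sq_add W.1 W.2
  rw [← imbalance] at h3
  have key : ∀ {p : ℕ} (U : Matrix (Fin p) (Fin d) ℝ), ‖Uᵀ * U‖ ^ 2 ≤ 19 * (d * σ₁ ^ 2) →
      ‖U‖ ^ 2 ≤ l ^ 2 := fun U hU => by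
    have e1 := norm_pow_four_le U
    have e2 : (‖U‖ ^ 2) ^ 2 ≤ (l ^ 2) ^ 2 := by
      rw [hp.l_sq]
      have := mul_le_mul_of_nonneg_left hU (by linarith : (0 : ℝ) ≤ d)
      nlinarith [sq_nonneg ((d : ℝ) * σ₁)]
    exact le_of_sq_le_sq e2 (sq_nonneg _)
  exact ⟨key W.1 (by linarith [sq_nonneg ‖W.2ᵀ * W.2‖]),
    key W.2 (by linarith [sq_nonneg ‖W.1ᵀ * W.1‖])⟩

lemma Controlled.descent {W : Matrix (Fin m) (Fin d) ℝ × Matrix (Fin n) (Fin d) ℝ}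
    (hp : SmallParams d σ₁ σd η r s₀ l) (hS : ‖S‖ ^ 2 ≤ d * σ₁ ^ 2)
    (hW : Controlled S Φ Ψ σ₁ η r W) :
    ‖S - (gdStep S η W).1 * (gdStep S η W).2ᵀ‖ ^ 2 ≤ ‖S - W.1 * W.2ᵀ‖ ^ 2
      - η * (‖(S - W.1 * W.2ᵀ) * W.2‖ ^ 2 + ‖(S - W.1 * W.2ᵀ)ᵀ * W.1‖ ^ 2) := by
  obtain ⟨hU, hV⟩ := hW.factors_sq_le hp hS
  refine norm_residual_gdStep_sq_le S hp.step_pos W.1 W.2 hU hV ?_ hp.step_mul_l_sq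
  refine le_of_sq_le_sq (hW.residual.trans ?_) (sq_nonneg _)
  rw [hp.l_sq]
  nlinarith [hp.d_pos, sq_nonneg σ₁, mul_nonneg (sub_nonneg.mpr hp.d_pos) (sq_nonneg σ₁)]

lemma Controlled.perp_left_gdStep {W : Matrix (Fin m) (Fin d) ℝ × Matrix (Fin n) (Fin d) ℝ}
    (h : IsThinSVD S Φ Ψ H σ₁ σd)
    (hp : SmallParams d σ₁ σd η r s₀ l) (hS : ‖S‖ ^ 2 ≤ d * σ₁ ^ 2)
    (hW : Controlled S Φ Ψ σ₁ η r W) :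
    ‖perp Φ (gdStep S η W).1‖ ^ 2 ≤ ‖perp Φ W.1‖ ^ 2 - η * ‖W.2 * (perp Φ W.1)ᵀ‖ ^ 2 := by
  obtain ⟨hU, hV⟩ := hW.factors_sq_le hp hS
  have h1 : (gdStep S η W).1 = W.1 + η • ((S - W.1 * W.2ᵀ) * W.2) := rfl
  rw [h1, h.perp_step]
  refine norm_sub_mul_gram_sq_le _ _ hp.step_pos ?_
  have := mul_le_mul_of_nonneg_left hV hp.step_pos.le
  linarith [hp.step_mul_l_sq]

/-- Monotonicity suffices on this side: the potential contains the product `‖J‖² ‖K‖²`, which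
contracts as soon as `J` does. -/
lemma Controlled.perp_right_gdStep {W : Matrix (Fin m) (Fin d) ℝ × Matrix (Fin n) (Fin d) ℝ}
    (h : IsThinSVD S Φ Ψ H σ₁ σd)
    (hp : SmallParams d σ₁ σd η r s₀ l) (hS : ‖S‖ ^ 2 ≤ d * σ₁ ^ 2)
    (hW : Controlled S Φ Ψ σ₁ η r W) :
    ‖perp Ψ (gdStep S η W).2‖ ^ 2 ≤ ‖perp Ψ W.2‖ ^ 2 := by
  obtain ⟨hU, hV⟩ := hW.factors_sq_le hp hS
  rw [gdStep_snd, h.transpose.perp_step]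
  have h2 := norm_sub_mul_gram_sq_le (perp Ψ W.2) W.1 hp.step_pos (by
    have := mul_le_mul_of_nonneg_left hU hp.step_pos.le
    linarith [hp.step_mul_l_sq])
  have : 0 ≤ η * ‖W.1 * (perp Ψ W.2)ᵀ‖ ^ 2 := mul_nonneg hp.step_pos.le (sq_nonneg _)
  linarith

lemma Controlled.norm_le {W : Matrix (Fin m) (Fin d) ℝ × Matrix (Fin n) (Fin d) ℝ}
    (hp : SmallParams d σ₁ σd η r s₀ l) (hS : ‖S‖ ^ 2 ≤ d * σ₁ ^ 2)
    (hW : Controlled S Φ Ψ σ₁ η r W) : ‖W.1‖ ≤ l ∧ ‖W.2‖ ≤ l :=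
  ⟨le_of_sq_le_sq (hW.factors_sq_le hp hS).1 hp.l_nonneg,
    le_of_sq_le_sq (hW.factors_sq_le hp hS).2 hp.l_nonneg⟩

/-- The growth of the imbalance is at most `η` times the drop of the squared residual, so the sum in
`drift` cannot increase. For the half difference, the forcing is at most `(η/2) σd r`, exactly what
the contraction of a norm `r` gives back. -/
lemma Controlled.gdStep {W : Matrix (Fin m) (Fin d) ℝ × Matrix (Fin n) (Fin d) ℝ}
    (h : IsThinSVD S Φ Ψ H σ₁ σd)
    (hp : SmallParams d σ₁ σd η r s₀ l) (hS : ‖S‖ ^ 2 ≤ d * σ₁ ^ 2)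
    (hW : Controlled S Φ Ψ σ₁ η r W) : Controlled S Φ Ψ σ₁ η r (gdStep S η W) := by
  have hη := hp.step_pos
  have hdesc := hW.descent hp hS
  have hg : 0 ≤ η * (‖(S - W.1 * W.2ᵀ) * W.2‖ ^ 2 + ‖(S - W.1 * W.2ᵀ)ᵀ * W.1‖ ^ 2) := by
    positivity
  refine ⟨by linarith [hW.residual], ?_, ?_, ?_, ?_⟩
  · have h1 : ‖imbalance (MatFac.gdStep S η W)‖ ≤ _ := imbalance_gdStep S η W.1 W.2
    rw [← imbalance] at h1
    have h2 := mul_le_mul_of_nonneg_left hdesc hη.le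
    have h3 := hW.drift
    linarith
  · have h1 := hW.perp_left_gdStep h hp hS
    have h2 : 0 ≤ η * ‖W.2 * (perp Φ W.1)ᵀ‖ ^ 2 := by positivity
    exact (le_of_sq_le_sq (by linarith) (norm_nonneg _)).trans hW.left
  · exact (le_of_sq_le_sq (hW.perp_right_gdStep h hp hS) (norm_nonneg _)).trans hW.right
  · obtain ⟨hU, hV⟩ := hW.factors_sq_le hp hS
    obtain ⟨hU', hV'⟩ := hW.norm_le hp hS
    have h1 := norm_halfDiff_gdStep_le h hη hp.σd_pos (norm_meanGram_le hU hV) (by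
      have e1 : (σ₁ + l ^ 2) ^ 2 ≤ (2 * l ^ 2) ^ 2 := by
        have := hp.l_sq_ge
        have := hp.σ₁_pos
        gcongr; linarith
      have e2 := mul_le_mul_of_nonneg_left e1 hη.le
      have e3 := hp.step_smooth
      have e4 : 0 ≤ η * (l ^ 2) ^ 2 := by positivity
      linarith) (by linarith [hp.step_mul_σd])
    have h2 : ‖halfSum Φ Ψ W‖ * ‖imbalance W‖ ≤ σd * r := by
      calc _ ≤ l * (3 * r ^ 2) := mul_le_mul (norm_halfSum_le h hU' hV') (hW.imbalance_le hη)
            (norm_nonneg _) hp.l_nonneg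
        _ = (3 * (l * r)) * r := by ring
        _ ≤ σd * r := mul_le_mul_of_nonneg_right hp.l_mul_r_le hp.r_nonneg
    have h3 := mul_le_mul_of_nonneg_left hW.diff
      (by linarith [hp.step_mul_σd] : 0 ≤ 1 - η * σd / 2)
    have h4 := mul_le_mul_of_nonneg_left h2 (by positivity : 0 ≤ η / 2)
    linarith

/-- Small initial factors satisfy the invariant. -/
lemma Controlled.of_small {W : Matrix (Fin m) (Fin d) ℝ × Matrix (Fin n) (Fin d) ℝ}
    (h : IsThinSVD S Φ Ψ H σ₁ σd)
    (hp : SmallParams d σ₁ σd η r s₀ l) (hS : ‖S‖ ^ 2 ≤ d * σ₁ ^ 2)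
    (hU : ‖W.1‖ ^ 2 + ‖W.2‖ ^ 2 ≤ r ^ 2) : Controlled S Φ Ψ σ₁ η r W := by
  have hU1 : ‖W.1‖ ≤ r := le_of_sq_le_sq (by linarith [sq_nonneg ‖W.2‖]) hp.r_nonneg
  have hV1 : ‖W.2‖ ≤ r := le_of_sq_le_sq (by linarith [sq_nonneg ‖W.1‖]) hp.r_nonneg
  have hres : ‖S - W.1 * W.2ᵀ‖ ^ 2 ≤ 4 * (d * σ₁ ^ 2) := by
    have e1 : ‖W.1 * W.2ᵀ‖ ≤ r ^ 2 := by
      refine (Matrix.frobenius_norm_mul _ _).trans ?_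
      rw [Matrix.frobenius_norm_transpose, sq]
      exact mul_le_mul hU1 hV1 (norm_nonneg _) hp.r_nonneg
    have e2 : ‖W.1 * W.2ᵀ‖ ≤ σ₁ := by linarith [hp.r_sq_le, hp.σd_le, sq_nonneg r]
    have e3 := pow_le_pow_left₀ (norm_nonneg _) e2 2
    have e4 := pow_le_pow_left₀ (norm_nonneg _) (norm_sub_le S (W.1 * W.2ᵀ)) 2
    have e5 : σ₁ ^ 2 ≤ d * σ₁ ^ 2 := by nlinarith [hp.d_pos, sq_nonneg σ₁]
    nlinarith [sq_nonneg (‖S‖ - ‖W.1 * W.2ᵀ‖)]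
  refine ⟨hres, ?_, (norm_perp_le h.orthoLeft _).trans hU1,
    (norm_perp_le h.orthoRight _).trans hV1, norm_halfDiff_le h hU1 hV1⟩
  have h1 : ‖imbalance W‖ ≤ ‖W.1‖ ^ 2 + ‖W.2‖ ^ 2 :=
    (norm_sub_le _ _).trans
      (add_le_add (norm_transpose_mul_self_le _) (norm_transpose_mul_self_le _))
  have h2 := mul_le_mul_of_nonneg_left hres hp.step_pos.le
  have h3 := hp.step_drift
  nlinarith [sq_nonneg r]

/-- The smallest singular value of the half sum grows geometrically up to `√σd / 4`. -/
lemma Controlled.belowBy_gdStep {W : Matrix (Fin m) (Fin d) ℝ × Matrix (Fin n) (Fin d) ℝ} {s : ℝ}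
    (h : IsThinSVD S Φ Ψ H σ₁ σd)
    (hp : SmallParams d σ₁ σd η r s₀ l) (hS : ‖S‖ ^ 2 ≤ d * σ₁ ^ 2)
    (hW : Controlled S Φ Ψ σ₁ η r W) (hs : s₀ ≤ s) (hsσ : 16 * s ^ 2 ≤ σd)
    (hA : BelowBy (halfSum Φ Ψ W) s) :
    BelowBy (halfSum Φ Ψ (MatFac.gdStep S η W)) ((1 + η * σd / 4) * s) := by
  have hη := hp.step_pos
  obtain ⟨hU, hV⟩ := hW.factors_sq_le hp hS
  obtain ⟨hU', hV'⟩ := hW.norm_le hp hS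
  have hr2 : r ^ 2 ≤ σ₁ := by linarith [hp.r_sq_le, hp.σd_le, sq_nonneg r]
  have hl := hp.l_nonneg
  refine hA.halfSum_gdStep h hη hp.σ₁_pos.le hp.σd_pos (hp.s_pos.le.trans hs) hsσ
    (norm_halfSum_le h hU' hV') (e := 2 * r ^ 2) ?_ (by linarith [hp.r_sq_le, sq_nonneg r])
    (norm_meanGram_le hU hV) (β := r * (3 * r ^ 2)) ?_ (by linarith [hp.step_mul_l_sq])
    (by linarith [hp.step_mul_σd]) (by linarith [hp.step_mul_σ₁]) ?_
  · refine (norm_gramError_le W).trans ?_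
    have e1 := pow_le_pow_left₀ (norm_nonneg _) hW.diff 2
    have e2 := pow_le_pow_left₀ (norm_nonneg _) hW.left 2
    have e3 := pow_le_pow_left₀ (norm_nonneg _) hW.right 2
    linarith
  · exact mul_le_mul hW.diff (hW.imbalance_le hη) (norm_nonneg _) hp.r_nonneg
  · have e1 : η * (l ^ 3 * r ^ 2) ≤ η * (σ₁ * l ^ 3) := by
      have : l ^ 3 * r ^ 2 ≤ l ^ 3 * σ₁ := mul_le_mul_of_nonneg_left hr2 (by positivity)
      have := mul_le_mul_of_nonneg_left this hη.le
      linarith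
    have e2 := hp.step_growth
    have e3 := hp.r_cube_le
    have e4 := mul_le_mul_of_nonneg_left hs hp.σd_pos.le
    have e5 : r * (3 * r ^ 2) / 2 = 3 / 2 * r ^ 3 := by ring
    have e6 : η * (σ₁ * (l * l ^ 2)) = η * (σ₁ * l ^ 3) := by ring
    have e7 : 2 * η * (l ^ 3 * (2 * r ^ 2)) = 4 * (η * (l ^ 3 * r ^ 2)) := by ring
    rw [e5, e6, e7]
    linarith

lemma gdIter_succ (S : Matrix (Fin m) (Fin n) ℝ) (η : ℝ)
    (W : Matrix (Fin m) (Fin d) ℝ × Matrix (Fin n) (Fin d) ℝ) (t : ℕ) :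
    gdIter S η W (t + 1) = gdStep S η (gdIter S η W t) := by
  simp only [gdIter, Function.iterate_succ_apply']

lemma Controlled.gdIter {W : Matrix (Fin m) (Fin d) ℝ × Matrix (Fin n) (Fin d) ℝ}
    (h : IsThinSVD S Φ Ψ H σ₁ σd)
    (hp : SmallParams d σ₁ σd η r s₀ l) (hS : ‖S‖ ^ 2 ≤ d * σ₁ ^ 2)
    (hW : Controlled S Φ Ψ σ₁ η r W) (t : ℕ) : Controlled S Φ Ψ σ₁ η r (gdIter S η W t) := by
  induction t with
  | zero => exact hW
  | succ t ih => rw [gdIter_succ]; exact ih.gdStep h hp hS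

/-- Growth is available only below `√σd / 4`, hence the cap. One step multiplies the capped bound by
a factor at least `1`, so the cap is never lost once reached. -/
lemma belowBy_gdIter {W : Matrix (Fin m) (Fin d) ℝ × Matrix (Fin n) (Fin d) ℝ}
    (h : IsThinSVD S Φ Ψ H σ₁ σd)
    (hp : SmallParams d σ₁ σd η r s₀ l) (hS : ‖S‖ ^ 2 ≤ d * σ₁ ^ 2)
    (hW : Controlled S Φ Ψ σ₁ η r W) (hA : BelowBy (halfSum Φ Ψ W) s₀) (t : ℕ) :
    BelowBy (halfSum Φ Ψ (gdIter S η W t)) (min (Real.sqrt σd / 4) ((1 + η * σd / 4) ^ t * s₀)) := by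
  have hx : 0 ≤ η * σd / 4 := by have := hp.step_pos; have := hp.σd_pos; positivity
  induction t with
  | zero => exact hA.mono ((min_le_right _ _).trans (by simp))
  | succ t ih =>
    rw [gdIter_succ]
    have hs0 : s₀ ≤ Real.sqrt σd / 4 := by
      have : 4 * s₀ ≤ Real.sqrt σd := Real.le_sqrt_of_sq_le (by linarith [hp.s_sq_le])
      linarith
    have h1 : s₀ ≤ min (Real.sqrt σd / 4) ((1 + η * σd / 4) ^ t * s₀) :=
      le_min hs0 (le_mul_of_one_le_left hp.s_pos.le (one_le_pow₀ (by linarith)))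
    have h2 : 16 * min (Real.sqrt σd / 4) ((1 + η * σd / 4) ^ t * s₀) ^ 2 ≤ σd := by
      have e1 := pow_le_pow_left₀ (hp.s_pos.le.trans h1) (min_le_left _ _) 2
      have e2 := Real.sq_sqrt hp.σd_pos.le
      nlinarith
    refine ((hW.gdIter h hp hS t).belowBy_gdStep h hp hS h1 h2 ih).mono ?_
    rw [mul_min_of_nonneg _ _ (by linarith)]
    refine min_le_min ?_ (by rw [pow_succ']; linarith)
    exact le_mul_of_one_le_left (by positivity) (by linarith)

/-- One step of linear convergence of `‖residual‖² + ‖J‖² ‖K‖²` once the half sum has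
grown. -/
lemma Controlled.contraction {W : Matrix (Fin m) (Fin d) ℝ × Matrix (Fin n) (Fin d) ℝ}
    (h : IsThinSVD S Φ Ψ H σ₁ σd)
    (hp : SmallParams d σ₁ σd η r s₀ l) (hS : ‖S‖ ^ 2 ≤ d * σ₁ ^ 2)
    (hW : Controlled S Φ Ψ σ₁ η r W) (hA : BelowBy (halfSum Φ Ψ W) (Real.sqrt σd / 4)) :
    ‖S - (MatFac.gdStep S η W).1 * (MatFac.gdStep S η W).2ᵀ‖ ^ 2
      + ‖perp Φ (MatFac.gdStep S η W).1‖ ^ 2 * ‖perp Ψ (MatFac.gdStep S η W).2‖ ^ 2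
    ≤ (1 - η * σd / 256) *
      (‖S - W.1 * W.2ᵀ‖ ^ 2 + ‖perp Φ W.1‖ ^ 2 * ‖perp Ψ W.2‖ ^ 2) := by
  have hη := hp.step_pos
  have hsq := Real.sq_sqrt hp.σd_pos.le
  have hpos := Real.sqrt_pos.mpr hp.σd_pos
  have hr : r ≤ Real.sqrt σd / 8 :=
    le_of_sq_le_sq (by nlinarith [hp.r_sq_le, hp.σd_pos]) (by positivity)
  have ha : BelowBy (Φᵀ * W.1) (Real.sqrt σd / 8) := by
    rw [← halfSum_add_halfDiff Φ Ψ W]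
    exact (hA.add hW.diff).mono (by linarith)
  have hb : BelowBy (Ψᵀ * W.2) (Real.sqrt σd / 8) := by
    rw [← halfSum_sub_halfDiff Φ Ψ W, sub_eq_add_neg]
    exact (hA.add ((norm_neg _).trans_le hW.diff)).mono (by linarith)
  have hJ := pow_le_pow_left₀ (norm_nonneg _) hW.left 2
  have hK := pow_le_pow_left₀ (norm_nonneg _) hW.right 2
  have hs2 : (Real.sqrt σd / 8) ^ 2 = σd / 64 := by rw [div_pow, hsq]; norm_num
  have hPL := gradient_dominated h (by positivity : 0 < Real.sqrt σd / 8) W.1 W.2 ha hb (by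
    rw [hs2]; linarith [hp.r_sq_le, hp.σd_pos])
  rw [hs2] at hPL
  have hdesc := hW.descent hp hS
  have hleft : ‖perp Φ (MatFac.gdStep S η W).1‖ ^ 2 ≤ (1 - η * σd / 64) * ‖perp Φ W.1‖ ^ 2 := by
    have e1 := hW.perp_left_gdStep h hp hS
    have e2 : Real.sqrt σd / 8 * ‖(perp Φ W.1)ᵀ‖ ≤ ‖W.2 * (perp Φ W.1)ᵀ‖ := by
      refine (hb m _).trans ?_
      rw [Matrix.mul_assoc]
      exact norm_proj_le h.orthoRight _
    rw [Matrix.frobenius_norm_transpose] at e2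
    have e3 := pow_le_pow_left₀ (by positivity) e2 2
    rw [mul_pow, hs2] at e3
    have e4 := mul_le_mul_of_nonneg_left e3 hη.le
    linarith
  have hright := hW.perp_right_gdStep h hp hS
  have hprod : ‖perp Φ (MatFac.gdStep S η W).1‖ ^ 2 * ‖perp Ψ (MatFac.gdStep S η W).2‖ ^ 2
      ≤ (1 - η * σd / 64) * ‖perp Φ W.1‖ ^ 2 * ‖perp Ψ W.2‖ ^ 2 :=
    mul_le_mul hleft hright (sq_nonneg _) ((sq_nonneg _).trans hleft)
  have hPL' := mul_le_mul_of_nonneg_left hPL hη.le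
  have hw : 0 ≤ η * σd * (‖perp Φ W.1‖ ^ 2 * ‖perp Ψ W.2‖ ^ 2) := by
    have := hp.σd_pos
    positivity
  -- The residual gains `ησd‖P‖²/256` and loses `ησd xy/128`, while the product gains `ησd xy/64`.
  -- The net rate is at least `ησd/256` for both terms.
  generalize ‖perp Φ W.1‖ ^ 2 = x at *
  generalize ‖perp Ψ W.2‖ ^ 2 = y at *
  nlinarith

/-- Deterministic convergence: from a small initialization whose half sum is well conditioned,
the loss decreases geometrically after the half sum has grown to size `√σd / 4`. -/
theorem loss_gdIter_le {W : Matrix (Fin m) (Fin d) ℝ × Matrix (Fin n) (Fin d) ℝ}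
    (h : IsThinSVD S Φ Ψ H σ₁ σd)
    (hp : SmallParams d σ₁ σd η r s₀ l) (hS : ‖S‖ ^ 2 ≤ d * σ₁ ^ 2)
    (hU : ‖W.1‖ ^ 2 + ‖W.2‖ ^ 2 ≤ r ^ 2) (hA : BelowBy (halfSum Φ Ψ W) s₀)
    {t₁ : ℕ} (ht₁ : Real.sqrt σd / 4 ≤ (1 + η * σd / 4) ^ t₁ * s₀) (t : ℕ) :
    loss S (gdIter S η W (t₁ + t)).1 (gdIter S η W (t₁ + t)).2
      ≤ 5 * (d * σ₁ ^ 2) * (1 - η * σd / 256) ^ t := by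
  have hW := Controlled.of_small h hp hS hU
  have hx : 0 ≤ η * σd / 4 := by have := hp.step_pos; have := hp.σd_pos; positivity
  have hq : 0 ≤ 1 - η * σd / 256 := by linarith [hp.step_mul_σd]
  have key : ∀ t : ℕ, ‖S - (gdIter S η W (t₁ + t)).1 * (gdIter S η W (t₁ + t)).2ᵀ‖ ^ 2
      + ‖perp Φ (gdIter S η W (t₁ + t)).1‖ ^ 2 * ‖perp Ψ (gdIter S η W (t₁ + t)).2‖ ^ 2
      ≤ 5 * (d * σ₁ ^ 2) * (1 - η * σd / 256) ^ t := by
    intro t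
    induction t with
    | zero =>
      have hc := hW.gdIter h hp hS (t₁ + 0)
      have e1 := pow_le_pow_left₀ (norm_nonneg _) hc.left 2
      have e2 := pow_le_pow_left₀ (norm_nonneg _) hc.right 2
      have e3 := mul_le_mul e1 e2 (sq_nonneg _) (sq_nonneg _)
      have e4 : r ^ 2 ≤ σ₁ := by linarith [hp.r_sq_le, hp.σd_le, sq_nonneg r]
      have e5 := mul_le_mul e4 e4 (sq_nonneg _) hp.σ₁_pos.le
      have e6 : σ₁ ^ 2 ≤ d * σ₁ ^ 2 := by nlinarith [hp.d_pos, sq_nonneg σ₁]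
      rw [pow_zero, mul_one]
      nlinarith [hc.residual]
    | succ t ih =>
      rw [← add_assoc, gdIter_succ]
      have hc := hW.gdIter h hp hS (t₁ + t)
      have hb := belowBy_gdIter h hp hS hW hA (t₁ + t)
      rw [min_eq_left] at hb
      · refine (hc.contraction h hp hS hb).trans ?_
        exact (mul_le_mul_of_nonneg_left ih hq).trans (le_of_eq (by ring))
      · refine ht₁.trans (mul_le_mul_of_nonneg_right ?_ hp.s_pos.le)
        exact pow_le_pow_right₀ (by linarith) (Nat.le_add_right _ _)
  have h1 := key t
  rw [loss, norm_sub_rev]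
  have h2 : 0 ≤ ‖perp Φ (gdIter S η W (t₁ + t)).1‖ ^ 2 * ‖perp Ψ (gdIter S η W (t₁ + t)).2‖ ^ 2 := by
    positivity
  nlinarith [sq_nonneg ‖S - (gdIter S η W (t₁ + t)).1 * (gdIter S η W (t₁ + t)).2ᵀ‖]

end Convergence

end MatFac

namespace MatFac

open scoped Matrix.Norms.Frobenius

/-! ### Existence of the thin singular value decomposition. -/

section SVD

variable {m n d : ℕ}

lemma IsThinSVD.norm_sq_le {S : Matrix (Fin m) (Fin n) ℝ} {Φ : Matrix (Fin m) (Fin d) ℝ}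
    {Ψ : Matrix (Fin n) (Fin d) ℝ} {H : Matrix (Fin d) (Fin d) ℝ} {σ₁ σd : ℝ}
    (h : IsThinSVD S Φ Ψ H σ₁ σd) : ‖S‖ ^ 2 ≤ d * σ₁ ^ 2 := by
  have h1 : ‖S‖ ^ 2 = ‖H * Ψᵀ‖ ^ 2 := by
    rw [h.eq_mul, Matrix.mul_assoc, norm_sq_eq_ip, ip_mul_left, ← Matrix.mul_assoc, h.orthoLeft,
      Matrix.one_mul, norm_sq_eq_ip]
  have h2 : ‖Ψᵀ‖ ^ 2 = d := by
    rw [Matrix.frobenius_norm_transpose, norm_sq_eq_ip, ip_eq_trace, h.orthoRight]; simp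
  rw [h1]
  calc ‖H * Ψᵀ‖ ^ 2 ≤ (σ₁ * ‖Ψᵀ‖) ^ 2 := pow_le_pow_left₀ (norm_nonneg _) (h.upper n Ψᵀ) 2
    _ = d * σ₁ ^ 2 := by rw [mul_pow, h2]; ring

lemma diagonal_lower {σ : Fin d → ℝ} {c : ℝ} (hc : ∀ i, c ≤ σ i) (k : ℕ)
    (X : Matrix (Fin d) (Fin k) ℝ) : c * ‖X‖ ^ 2 ≤ ip X (Matrix.diagonal σ * X) := by
  rw [norm_sq_eq_sum, Finset.mul_sum, ip]
  refine Finset.sum_le_sum fun i _ => ?_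
  rw [Finset.mul_sum]
  refine Finset.sum_le_sum fun j _ => ?_
  rw [Matrix.diagonal_mul]
  nlinarith [mul_le_mul_of_nonneg_right (hc i) (sq_nonneg (X i j))]

lemma norm_diagonal_mul_le {σ : Fin d → ℝ} {c : ℝ} (h0 : ∀ i, 0 ≤ σ i) (hc0 : 0 ≤ c)
    (hc : ∀ i, σ i ≤ c) (k : ℕ)
    (X : Matrix (Fin d) (Fin k) ℝ) : ‖Matrix.diagonal σ * X‖ ≤ c * ‖X‖ := by
  refine le_of_sq_le_sq ?_ (by positivity)
  rw [mul_pow, norm_sq_eq_sum, norm_sq_eq_sum, Finset.mul_sum]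
  refine Finset.sum_le_sum fun i _ => ?_
  rw [Finset.mul_sum]
  refine Finset.sum_le_sum fun j _ => ?_
  rw [Matrix.diagonal_mul, mul_pow]
  exact mul_le_mul_of_nonneg_right (pow_le_pow_left₀ (h0 i) (hc i) 2) (sq_nonneg _)

lemma finrank_range_toEuclideanLin (S : Matrix (Fin m) (Fin n) ℝ) :
    Module.finrank ℝ (Matrix.toEuclideanLin S).range = S.rank := by
  rw [Matrix.rank_eq_finrank_range_toLin S (EuclideanSpace.basisFun (Fin m) ℝ).toBasis
    (EuclideanSpace.basisFun (Fin n) ℝ).toBasis, Matrix.toEuclideanLin_eq_toLin_orthonormal]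

lemma sval_pos {S : Matrix (Fin m) (Fin n) ℝ} {i : ℕ} (hi : i < S.rank) : 0 < sval S i := by
  rw [sval, LinearMap.singularValues_pos_iff_lt_finrank_range, finrank_range_toEuclideanLin]
  exact hi

/-- Existence of a thin singular value decomposition of a matrix of rank `d`. -/
theorem exists_isThinSVD (S : Matrix (Fin m) (Fin n) ℝ) (hS : S.rank = d) :
    ∃ (Φ : Matrix (Fin m) (Fin d) ℝ) (Ψ : Matrix (Fin n) (Fin d) ℝ)
      (H : Matrix (Fin d) (Fin d) ℝ), IsThinSVD S Φ Ψ H (sval S 0) (sval S (d - 1)) := by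
  set T := Matrix.toEuclideanLin S with hT
  have hn : Module.finrank ℝ (EuclideanSpace ℝ (Fin n)) = n := by simp
  have hdn : d ≤ n := hS ▸ (Matrix.rank_le_width S)
  set e := T.isSymmetric_adjoint_comp_self.eigenvectorBasis hn with he
  have hTe : ∀ i j, inner ℝ (T (e i)) (T (e j)) = if i = j then sval S i ^ 2 else 0 := by
    intro i j
    have h1 : inner ℝ (T (e i)) (T (e j)) = inner ℝ ((LinearMap.adjoint T ∘ₗ T) (e i)) (e j) := by
      rw [LinearMap.comp_apply, LinearMap.adjoint_inner_left]
    rw [h1, he, LinearMap.IsSymmetric.apply_eigenvectorBasis, ← he, inner_smul_left,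
      orthonormal_iff_ite.mp e.orthonormal, sval, ← hT, LinearMap.sq_singularValues_fin T hn]
    simp
  have hzero : ∀ i : Fin n, d ≤ i → T (e i) = 0 := by
    intro i hi
    have h1 := hTe i i
    have h2 : sval S i = 0 := by
      rw [sval, LinearMap.singularValues_eq_zero_iff_le_finrank_range,
        finrank_range_toEuclideanLin, hS]
      exact hi
    rw [if_pos rfl, h2, real_inner_self_eq_norm_sq] at h1
    simpa using h1
  have hpos : ∀ i : Fin d, 0 < sval S i := fun i => sval_pos (by rw [hS]; exact i.2)
  have hanti : Antitone (sval S) := T.singularValues_antitone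
  -- With `e` an eigenbasis of `T* T`, the right singular vectors are the first `d` of the `e i`,
  -- and the left ones are the `T (e i)` divided by their lengths `sval S i`. The other `e i` are
  -- killed by `T`.
  refine ⟨Matrix.of fun p i => T (e (Fin.castLE hdn i)) p / sval S i,
    Matrix.of fun q i => e (Fin.castLE hdn i) q, Matrix.diagonal fun i => sval S i, ?_, ?_, ?_, ?_,
    ?_, ?_⟩
  · ext i j
    have h1 := hTe (Fin.castLE hdn j) (Fin.castLE hdn i)
    rw [PiLp.inner_apply] at h1
    have h2 : ((Matrix.of fun p (i : Fin d) => T (e (Fin.castLE hdn i)) p / sval S i)ᵀ *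
        (Matrix.of fun p (i : Fin d) => T (e (Fin.castLE hdn i)) p / sval S i)) i j
        = (∑ p, T (e (Fin.castLE hdn i)) p * T (e (Fin.castLE hdn j)) p)
          / (sval S i * sval S j) := by
      simp only [Matrix.mul_apply, Matrix.transpose_apply, Matrix.of_apply, Finset.sum_div]
      exact Finset.sum_congr rfl fun p _ => by rw [div_mul_div_comm]
    simp only [RCLike.inner_apply, conj_trivial] at h1
    rw [h2, h1, Matrix.one_apply]
    have hi := (hpos i).ne'
    by_cases hij : i = j
    · subst hij
      simp only [if_true, Fin.val_castLE]
      field_simp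
    · rw [if_neg hij, if_neg (fun hc => hij (Fin.castLE_injective hdn hc).symm), zero_div]
  · ext i j
    have h1 := orthonormal_iff_ite.mp e.orthonormal (Fin.castLE hdn j) (Fin.castLE hdn i)
    rw [PiLp.inner_apply] at h1
    simp only [RCLike.inner_apply, conj_trivial] at h1
    simp only [Matrix.mul_apply, Matrix.transpose_apply, Matrix.of_apply]
    rw [h1, Matrix.one_apply]
    by_cases hij : i = j
    · subst hij; simp
    · rw [if_neg hij, if_neg (fun hc => hij (Fin.castLE_injective hdn hc).symm)]
  · ext p q
    have h1 : S p q = T (EuclideanSpace.single q 1) p := by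
      simp [hT, Matrix.toEuclideanLin]
    have h2 : T (EuclideanSpace.single q 1) = ∑ i, e i q • T (e i) := by
      conv_lhs => rw [← e.sum_repr' (EuclideanSpace.single q (1 : ℝ))]
      rw [map_sum]
      refine Finset.sum_congr rfl fun i _ => ?_
      rw [map_smul, real_inner_comm, EuclideanSpace.inner_single_left]
      simp
    have h3 : ∑ i, e i q • T (e i)
        = ∑ i : Fin d, e (Fin.castLE hdn i) q • T (e (Fin.castLE hdn i)) := by
      symm
      refine Finset.sum_of_injOn (Fin.castLE hdn) (Fin.castLE_injective hdn).injOn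
        (fun _ _ => Finset.mem_coe.mpr (Finset.mem_univ _)) (fun i _ hi => ?_) (fun _ _ => rfl)
      rw [hzero i, smul_zero]
      by_contra hlt
      push Not at hlt
      exact hi ⟨⟨i, hlt⟩, by simp, by ext; simp⟩
    rw [h1, h2, h3, Matrix.mul_apply]
    simp only [Matrix.mul_diagonal, Matrix.transpose_apply, Matrix.of_apply,
      WithLp.ofLp_sum, WithLp.ofLp_smul, Finset.sum_apply, Pi.smul_apply, smul_eq_mul]
    refine Finset.sum_congr rfl fun i _ => ?_
    have hi := (hpos i).ne'
    field_simp
  · exact Matrix.diagonal_transpose _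
  · exact diagonal_lower fun i => hanti (by omega)
  · exact norm_diagonal_mul_le (fun i => (hpos i).le) (LinearMap.singularValues_nonneg _ _)
      fun i => hanti (Nat.zero_le _)

end SVD

end MatFac

namespace MatFac

open MeasureTheory ProbabilityTheory

/-! ### Gaussian anticoncentration in slabs. -/

section Anticoncentration

/-- The density is at most `1 / (√(2π) ε) ≤ 1 / (2ε)`, and the interval has length `2τ`. -/
lemma gaussianReal_interval_le {ε τ c : ℝ} (hε : 0 < ε) :
    gaussianReal 0 (Real.toNNReal (ε ^ 2)) {z | |z + c| ≤ τ} ≤ ENNReal.ofReal (τ / ε) := by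
  have hv : Real.toNNReal (ε ^ 2) ≠ 0 := by
    rw [Ne, Real.toNNReal_eq_zero, not_le]; positivity
  have hset : {z : ℝ | |z + c| ≤ τ} = Set.Icc (-c - τ) (-c + τ) := by
    ext z
    simp only [Set.mem_ofPred_eq, Set.mem_Icc, abs_le]
    constructor <;> rintro ⟨h1, h2⟩ <;> constructor <;> linarith
  have hsqrt : 2 * ε ≤ Real.sqrt (2 * Real.pi * ε ^ 2) := by
    refine Real.le_sqrt_of_sq_le ?_
    nlinarith [Real.pi_gt_three, sq_nonneg ε]
  have hpdf : ∀ x, gaussianPDF 0 (Real.toNNReal (ε ^ 2)) x ≤ ENNReal.ofReal ((2 * ε)⁻¹) := by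
    intro x
    rw [gaussianPDF, gaussianPDFReal]
    refine ENNReal.ofReal_le_ofReal ?_
    rw [Real.coe_toNNReal _ (sq_nonneg ε)]
    have h1 : Real.exp (-(x - 0) ^ 2 / (2 * ε ^ 2)) ≤ 1 := by
      rw [Real.exp_le_one_iff]
      exact div_nonpos_of_nonpos_of_nonneg (by nlinarith [sq_nonneg x]) (by positivity)
    calc _ ≤ (Real.sqrt (2 * Real.pi * ε ^ 2))⁻¹ * 1 := by gcongr
      _ ≤ _ := by rw [mul_one]; gcongr
  rw [gaussianReal_apply _ hv, hset]
  calc _ ≤ ∫⁻ _ in Set.Icc (-c - τ) (-c + τ), ENNReal.ofReal ((2 * ε)⁻¹) :=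
        lintegral_mono fun x => hpdf x
    _ = ENNReal.ofReal (τ / ε) := by
        rw [setLIntegral_const, Real.volume_Icc, ← ENNReal.ofReal_mul (by positivity)]
        congr 1
        field_simp
        ring

variable {ι : Type*} [DecidableEq ι]

lemma lmarginal_const_le (μ : ι → Measure ℝ) [∀ i, IsProbabilityMeasure (μ i)] (s : Finset ι)
    (f : (ι → ℝ) → ENNReal) (β : ENNReal) (hf : ∀ x, f x ≤ β) (x : ι → ℝ) :
    lmarginal μ s f x ≤ β := by
  calc lmarginal μ s f x ≤ ∫⁻ _, β ∂(Measure.pi fun i : s => μ i) := lintegral_mono fun _ => hf _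
    _ = β := by simp

/-- Fubini: a bound on the conditional probability that is uniform in the frozen coordinates is a
bound on the probability. -/
lemma pi_le_of_lmarginal_le [Fintype ι] (μ : ι → Measure ℝ) [∀ i, IsProbabilityMeasure (μ i)] (s : Finset ι)
    {E : Set (ι → ℝ)} (hE : MeasurableSet E) {β : ENNReal}
    (h : ∀ x, lmarginal μ s (E.indicator 1) x ≤ β) : Measure.pi μ E ≤ β := by
  rw [← lintegral_indicator_one hE]
  calc _ ≤ ∫⁻ _, β ∂(Measure.pi μ) := by
        refine lintegral_le_of_lmarginal_le s (measurable_one.indicator hE) measurable_const ?_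
        intro x
        refine (h x).trans (le_of_eq ?_)
        simp [lmarginal]
    _ = β := by simp

/-- Conditionally on all coordinates outside `s`, an affine slab in which some coordinate `p ∈ s`
has coefficient `1` has small Gaussian measure. -/
lemma lmarginal_slab_le [Fintype ι] {ε τ : ℝ} (hε : 0 < ε) (s : Finset ι) {p : ι} (hp : p ∈ s)
    (a : ι → ℝ) (x : ι → ℝ) :
    lmarginal (fun _ : ι => gaussianReal 0 (Real.toNNReal (ε ^ 2))) s
      ({x : ι → ℝ | |x p + ∑ i ∈ Finset.univ.erase p, a i * x i| ≤ τ}.indicator 1) x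
      ≤ ENNReal.ofReal (τ / ε) := by
  have hm : MeasurableSet {x : ι → ℝ | |x p + ∑ i ∈ Finset.univ.erase p, a i * x i| ≤ τ} :=
    measurableSet_le (by fun_prop) measurable_const
  -- Integrate the coordinate `p` first. The sum omits `p`, so it is only a shift of a
  -- one-dimensional interval.
  rw [lmarginal_erase' _ (measurable_one.indicator hm) hp]
  refine lmarginal_const_le _ _ _ _ (fun y => ?_) x
  refine le_trans (le_of_eq ?_) (gaussianReal_interval_le hε
    (c := ∑ i ∈ Finset.univ.erase p, a i * y i))
  rw [← lintegral_indicator_one (measurableSet_le (by fun_prop) measurable_const)]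
  refine lintegral_congr fun z => ?_
  have : ∑ i ∈ Finset.univ.erase p, a i * Function.update y p z i
      = ∑ i ∈ Finset.univ.erase p, a i * y i :=
    Finset.sum_congr rfl fun i hi => by rw [Function.update_of_ne (Finset.ne_of_mem_erase hi)]
  simp only [Set.indicator, Set.mem_ofPred_eq, Function.update_self, this,
    Pi.one_apply]

end Anticoncentration

/-! ### Smallest singular value of a Gaussian matrix. -/

section SmallestSingularValue

variable {d : ℕ} {κ : Type*} [Fintype κ]

/-- The matrix `M X`, where `X` is the array `x` read as a matrix. -/
def mulArray (M : Matrix (Fin d) κ ℝ) (x : κ × Fin d → ℝ) : Matrix (Fin d) (Fin d) ℝ :=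
  M * Matrix.of fun q j => x (q, j)

/-- The arrays for which `M X` nearly kills a unit vector with a large `j`-th coordinate. -/
def nearKernel (M : Matrix (Fin d) κ ℝ) (t : ℝ) (j : Fin d) : Set (κ × Fin d → ℝ) :=
  {x | ∃ y : Fin d → ℝ, y ⬝ᵥ y = 1 ∧ 1 ≤ d * y j ^ 2 ∧
    (mulArray M x *ᵥ y) ⬝ᵥ (mulArray M x *ᵥ y) ≤ t ^ 2}

/-- Closedness supplies measurability despite the uncountable existential: the set is the projection
of a closed set along a compact set of vectors `y`. -/
lemma isClosed_nearKernel (M : Matrix (Fin d) κ ℝ) (t : ℝ) (j : Fin d) :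
    IsClosed (nearKernel M t j) := by
  set K : Set (Fin d → ℝ) := {y | y ⬝ᵥ y = 1 ∧ 1 ≤ d * y j ^ 2} with hK
  have hKc : IsClosed K := by
    have h1 : IsClosed {y : Fin d → ℝ | y ⬝ᵥ y = 1} :=
      isClosed_eq (by simp only [dotProduct]; fun_prop) continuous_const
    have h2 : IsClosed {y : Fin d → ℝ | 1 ≤ d * y j ^ 2} :=
      isClosed_le continuous_const (by fun_prop)
    exact h1.inter h2
  have hKcomp : IsCompact K := by
    refine (isCompact_Icc (a := fun _ : Fin d => (-1 : ℝ)) (b := fun _ => 1)).of_isClosed_subset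
      hKc ?_
    rintro y ⟨hy, -⟩
    have : ∀ i, |y i| ≤ 1 := fun i => by
      rw [← sq_le_one_iff_abs_le_one, ← hy]
      simp only [dotProduct, ← sq]
      exact Finset.single_le_sum (f := fun i => y i ^ 2) (fun _ _ => sq_nonneg _)
        (Finset.mem_univ i)
    exact ⟨fun i => (abs_le.mp (this i)).1, fun i => (abs_le.mp (this i)).2⟩
  have : CompactSpace K := isCompact_iff_compactSpace.mp hKcomp
  have h : Continuous fun z : (κ × Fin d → ℝ) × (Fin d → ℝ) =>
      (mulArray M z.1 *ᵥ z.2) ⬝ᵥ (mulArray M z.1 *ᵥ z.2) := by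
    simp only [mulArray, dotProduct, Matrix.mulVec, Matrix.mul_apply, Matrix.of_apply]
    fun_prop
  have hι : Continuous fun z : (κ × Fin d → ℝ) × K => (z.1, z.2.1) := by fun_prop
  convert isClosedMap_fst_of_compactSpace _
    ((isClosed_le h (continuous_const (y := t ^ 2))).preimage hι) using 1
  ext x
  simp only [nearKernel, Set.mem_ofPred_eq, Set.mem_image, Set.mem_preimage, Prod.exists, exists_and_right,
    exists_eq_right, Subtype.exists, hK]
  constructor
  · rintro ⟨y, h1, h2, h3⟩; exact ⟨y, ⟨h1, h2⟩, h3⟩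
  · rintro ⟨y, ⟨h1, h2⟩, h3⟩; exact ⟨y, h1, h2, h3⟩

/-- For each choice of the columns other than `j`, the `nearKernel` set lies in a slab. -/
lemma exists_slab [DecidableEq κ] (M : Matrix (Fin d) κ ℝ)
    (hM : ∀ w : Fin d → ℝ, w ⬝ᵥ w ≤ (w ᵥ* M) ⬝ᵥ (w ᵥ* M)) {t : ℝ} (ht : 0 ≤ t) (j : Fin d)
    (x₀ : κ × Fin d → ℝ) :
    ∃ (q₀ : κ) (a : κ × Fin d → ℝ), ∀ x ∈ nearKernel M t j,
      (∀ q i, i ≠ j → x (q, i) = x₀ (q, i)) →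
      |x (q₀, j) + ∑ z ∈ Finset.univ.erase (q₀, j), a z * x z|
        ≤ t * Real.sqrt (d * Fintype.card κ) := by
  -- `w` is orthogonal to every column except `j`. It is built from `x₀` alone, so the slab does not
  -- depend on column `j`.
  obtain ⟨w, hw0, hw⟩ : ∃ w : Fin d → ℝ, w ≠ 0 ∧ w ᵥ* ((mulArray M x₀).updateCol j 0) = 0 :=
    Matrix.exists_vecMul_eq_zero_iff.mpr
      (Matrix.det_eq_zero_of_column_eq_zero j fun i => by simp)
  have hwpos : 0 < w ⬝ᵥ w := by
    refine lt_of_le_of_ne (Finset.sum_nonneg fun i _ => mul_self_nonneg _) (Ne.symm ?_)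
    rwa [Ne, dotProduct_self_eq_zero]
  set c := w ᵥ* M with hc
  -- Averaging: since `c = wM` is at least as long as `w`, some coordinate satisfies `c q₀² ≥ |w|² /
  -- card κ`. Dividing by it normalizes a coefficient of the slab to `1`.
  obtain ⟨q₀, hq₀⟩ : ∃ q, w ⬝ᵥ w ≤ Fintype.card κ * c q ^ 2 := by
    by_contra! hcon
    have hne : Nonempty κ := by
      by_contra hemp
      rw [not_nonempty_iff] at hemp
      have := hM w
      simp only [dotProduct, Finset.univ_eq_empty (α := κ), Finset.sum_empty] at this
      simp only [dotProduct] at hwpos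
      linarith
    have h1 := Finset.sum_lt_sum_of_nonempty (Finset.univ_nonempty (α := κ))
      (fun q _ => hcon q)
    rw [← Finset.mul_sum, Finset.sum_const, Finset.card_univ, nsmul_eq_mul] at h1
    have h2 : ∑ q, c q ^ 2 = c ⬝ᵥ c := by simp only [dotProduct, sq]
    rw [h2] at h1
    have h3 : (0 : ℝ) < Fintype.card κ := by exact_mod_cast Fintype.card_pos
    nlinarith [hM w]
  have hκ : (0 : ℝ) ≤ Fintype.card κ := Nat.cast_nonneg _
  have hcq : c q₀ ≠ 0 := by
    intro h0
    rw [h0] at hq₀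
    nlinarith
  refine ⟨q₀, fun z => if z.2 = j then c z.1 / c q₀ else 0, fun x hx hxe => ?_⟩
  obtain ⟨y, hy1, hyj, hyt⟩ := hx
  set A := mulArray M x with hA
  have hcols : ∀ i, i ≠ j → (w ᵥ* A) i = 0 := fun i hi => by
    have h1 := congrFun hw i
    simp only [Matrix.vecMul, dotProduct, Pi.zero_apply] at h1 ⊢
    rw [← h1]
    refine Finset.sum_congr rfl fun k _ => ?_
    rw [Matrix.updateCol_ne hi]
    simp only [hA, mulArray, Matrix.mul_apply, Matrix.of_apply]
    congr 1
    exact Finset.sum_congr rfl fun q _ => by rw [hxe q i hi]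
  have hcolj : (w ᵥ* A) j = ∑ q, c q * x (q, j) := by
    rw [hA, mulArray, ← Matrix.vecMul_vecMul]
    simp only [Matrix.vecMul, dotProduct, Matrix.of_apply, hc]
  set g := ∑ q, c q * x (q, j) with hg
  -- Only column `j` survives pairing with `w`, so a small `A y` with `d y_j² ≥ 1` forces the linear
  -- form `g` of that column to be small.
  have hwv : w ⬝ᵥ (A *ᵥ y) = g * y j := by
    rw [Matrix.dotProduct_mulVec, dotProduct,
      Finset.sum_eq_single j (fun i _ hi => by rw [hcols i hi, zero_mul]) (by simp), hcolj]
  have hCS : (w ⬝ᵥ (A *ᵥ y)) ^ 2 ≤ (w ⬝ᵥ w) * t ^ 2 := by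
    have h1 := Finset.sum_mul_sq_le_sq_mul_sq Finset.univ w (A *ᵥ y)
    have h2 : ∑ i, w i ^ 2 = w ⬝ᵥ w := by simp only [dotProduct, sq]
    have h3 : ∑ i, (A *ᵥ y) i ^ 2 = (A *ᵥ y) ⬝ᵥ (A *ᵥ y) := by simp only [dotProduct, sq]
    rw [h2, h3] at h1
    exact h1.trans (mul_le_mul_of_nonneg_left hyt hwpos.le)
  rw [hwv] at hCS
  have hd0 : (0 : ℝ) ≤ d := Nat.cast_nonneg _
  have hg2 : g ^ 2 ≤ d * (w ⬝ᵥ w) * t ^ 2 := by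
    have h1 : g ^ 2 * 1 ≤ g ^ 2 * (d * y j ^ 2) := mul_le_mul_of_nonneg_left hyj (sq_nonneg _)
    have h2 := mul_le_mul_of_nonneg_left hCS hd0
    nlinarith
  have hgc : (g / c q₀) ^ 2 ≤ t ^ 2 * (d * Fintype.card κ) := by
    rw [div_pow, div_le_iff₀ (by positivity)]
    have h1 := mul_le_mul_of_nonneg_left hq₀ (mul_nonneg hd0 (sq_nonneg t))
    nlinarith
  have hsum : x (q₀, j) + ∑ z ∈ Finset.univ.erase (q₀, j),
      (if z.2 = j then c z.1 / c q₀ else 0) * x z = g / c q₀ := by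
    have h1 : ∑ z, (if z.2 = j then c z.1 / c q₀ else 0) * x z = g / c q₀ := by
      rw [Fintype.sum_prod_type, hg, Finset.sum_div]
      refine Finset.sum_congr rfl fun q _ => ?_
      rw [Finset.sum_eq_single j (fun i _ hi => by simp [hi]) (by simp)]
      simp only [if_true]
      ring
    rw [← h1, ← Finset.add_sum_erase _ _ (Finset.mem_univ (q₀, j))]
    simp [hcq]
  rw [hsum]
  refine abs_le_of_sq_le_sq ?_ (by positivity)
  rw [mul_pow, Real.sq_sqrt (by positivity)]
  exact hgc

/-- Integrate over column `j` with the other columns frozen: the event then lies in the slab of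
`exists_slab`. -/
lemma pi_nearKernel_le [DecidableEq κ] (M : Matrix (Fin d) κ ℝ)
    (hM : ∀ w : Fin d → ℝ, w ⬝ᵥ w ≤ (w ᵥ* M) ⬝ᵥ (w ᵥ* M)) {t ε : ℝ} (ht : 0 ≤ t) (hε : 0 < ε)
    (j : Fin d) :
    Measure.pi (fun _ : κ × Fin d => gaussianReal 0 (Real.toNNReal (ε ^ 2))) (nearKernel M t j)
      ≤ ENNReal.ofReal (t * Real.sqrt (d * Fintype.card κ) / ε) := by
  refine pi_le_of_lmarginal_le _ (Finset.univ.filter fun z : κ × Fin d => z.2 = j)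
    (isClosed_nearKernel M t j).measurableSet fun x₀ => ?_
  obtain ⟨q₀, a, ha⟩ := exists_slab M hM ht j x₀
  refine le_trans ?_ (lmarginal_slab_le hε
    (Finset.univ.filter fun z : κ × Fin d => z.2 = j) (p := (q₀, j)) (by simp) a x₀)
  refine lintegral_mono fun y => ?_
  by_cases hx : Function.updateFinset x₀ (Finset.univ.filter fun z : κ × Fin d => z.2 = j) y
      ∈ nearKernel M t j
  · have hmem := ha _ hx fun q i hi => by simp [Function.updateFinset, hi]
    rw [Set.indicator_of_mem hx, Set.indicator_of_mem (Set.mem_ofPred_eq ▸ hmem)]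
  · rw [Set.indicator_of_notMem hx]
    exact zero_le

open scoped Matrix.Norms.Frobenius in
/-- Outside the `nearKernel` sets, all singular values of `M X` are at least `t`. -/
lemma belowBy_mulArray (M : Matrix (Fin d) κ ℝ) {t : ℝ} {x : κ × Fin d → ℝ}
    (hx : ∀ j, x ∉ nearKernel M t j) : BelowBy (mulArray M x) t := by
  have hvec : ∀ y : Fin d → ℝ, t ^ 2 * (y ⬝ᵥ y)
      ≤ (mulArray M x *ᵥ y) ⬝ᵥ (mulArray M x *ᵥ y) := by
    intro y
    by_contra! hlt
    have hyy : 0 ≤ y ⬝ᵥ y := Finset.sum_nonneg fun i _ => mul_self_nonneg _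
    have hAy : 0 ≤ (mulArray M x *ᵥ y) ⬝ᵥ (mulArray M x *ᵥ y) :=
      Finset.sum_nonneg fun i _ => mul_self_nonneg _
    have hpos : 0 < y ⬝ᵥ y := by
      rcases hyy.eq_or_lt with h0 | h0
      · rw [← h0] at hlt; linarith
      · exact h0
    -- Some coordinate carries at least the average `|y|² / d`, which decides which `nearKernel` set
    -- is hit.
    obtain ⟨j, hj⟩ : ∃ j, y ⬝ᵥ y ≤ d * y j ^ 2 := by
      by_contra! hcon
      have hne : Nonempty (Fin d) := by
        by_contra hemp
        rw [not_nonempty_iff] at hemp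
        simp [dotProduct] at hpos
      have h1 := Finset.sum_lt_sum_of_nonempty (Finset.univ_nonempty (α := Fin d))
        (fun q _ => hcon q)
      rw [← Finset.mul_sum, Finset.sum_const, Finset.card_univ, nsmul_eq_mul,
        Fintype.card_fin] at h1
      have h2 : ∑ q, y q ^ 2 = y ⬝ᵥ y := by simp only [dotProduct, sq]
      rw [h2] at h1
      exact lt_irrefl _ h1
    have hsq := Real.sq_sqrt hyy
    have hs := Real.sqrt_pos.mpr hpos
    refine hx j ⟨(Real.sqrt (y ⬝ᵥ y))⁻¹ • y, ?_, ?_, ?_⟩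
    · rw [smul_dotProduct, dotProduct_smul, smul_eq_mul, smul_eq_mul, ← mul_assoc, ← sq,
        inv_pow, hsq, inv_mul_cancel₀ hpos.ne']
    · rw [Pi.smul_apply, smul_eq_mul, mul_pow, inv_pow, hsq, ← mul_assoc, mul_comm (d : ℝ),
        mul_assoc, ← div_eq_inv_mul, le_div_iff₀ hpos, one_mul]
      exact hj
    · rw [Matrix.mulVec_smul, smul_dotProduct, dotProduct_smul, smul_eq_mul, smul_eq_mul,
        ← mul_assoc, ← sq, inv_pow, hsq, ← div_eq_inv_mul, div_le_iff₀ hpos]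
      exact hlt.le
  intro k X
  refine le_of_sq_le_sq ?_ (norm_nonneg _)
  have hcol : ∀ Y : Matrix (Fin d) (Fin k) ℝ,
      ‖Y‖ ^ 2 = ∑ j, (fun i => Y i j) ⬝ᵥ (fun i => Y i j) := fun Y => by
    rw [norm_sq_eq_sum, Finset.sum_comm]; simp only [dotProduct, sq]
  rw [mul_pow, hcol, hcol, Finset.mul_sum]
  exact Finset.sum_le_sum fun j _ => hvec fun i => X i j

end SmallestSingularValue

end MatFac

namespace MatFac

open MeasureTheory ProbabilityTheory
open scoped Matrix.Norms.Frobenius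

/-! ### The Gaussian initialization is good with high probability. -/

section Initialization

variable {m n d : ℕ}

/-- A pair of arrays as one array indexed by `(Fin m ⊕ Fin n) × Fin d`. -/
def stack (W : (Fin m → Fin d → ℝ) × (Fin n → Fin d → ℝ)) (z : (Fin m ⊕ Fin n) × Fin d) : ℝ :=
  Sum.elim (fun i => W.1 i z.2) (fun i => W.2 i z.2) z.1

lemma measurable_stack : Measurable (stack (m := m) (n := n) (d := d)) := by
  refine measurable_pi_iff.mpr fun z => ?_
  rcases z with ⟨i | i, j⟩ <;> simp only [stack, Sum.elim_inl, Sum.elim_inr] <;> fun_prop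

lemma map_stack_gaussianInit (ε : ℝ) :
    (gaussianInit m n d ε).map stack
      = Measure.pi fun _ : (Fin m ⊕ Fin n) × Fin d => gaussianReal 0 (Real.toNNReal (ε ^ 2)) := by
  symm
  refine Measure.pi_eq fun s hs => ?_
  have hpre : stack ⁻¹' (Set.univ.pi s)
      = (Set.univ.pi fun i : Fin m => Set.univ.pi fun j : Fin d => s (Sum.inl i, j)) ×ˢ
        (Set.univ.pi fun i : Fin n => Set.univ.pi fun j : Fin d => s (Sum.inr i, j)) := by
    ext W
    simp only [Set.mem_preimage, Set.mem_pi, Set.mem_univ, true_imp_iff, Set.mem_prod, Prod.forall,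
      Sum.forall, stack, Sum.elim_inl, Sum.elim_inr]
  rw [Measure.map_apply measurable_stack (MeasurableSet.univ_pi hs), hpre, gaussianInit,
    Measure.prod_prod, Measure.pi_pi, Measure.pi_pi, Fintype.prod_prod_type, Fintype.prod_sum_type]
  simp only [Measure.pi_pi]

lemma measurePreserving_stack (ε : ℝ) :
    MeasurePreserving stack (gaussianInit m n d ε)
      (Measure.pi fun _ : (Fin m ⊕ Fin n) × Fin d => gaussianReal 0 (Real.toNNReal (ε ^ 2))) :=
  ⟨measurable_stack, map_stack_gaussianInit ε⟩

lemma lintegral_sq_gaussianReal (ε : ℝ) :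
    ∫⁻ x, ENNReal.ofReal (x ^ 2) ∂(gaussianReal 0 (Real.toNNReal (ε ^ 2)))
      = ENNReal.ofReal (ε ^ 2) := by
  have h1 := evariance_eq_lintegral_ofReal id (gaussianReal 0 (Real.toNNReal (ε ^ 2)))
  have h2 := (memLp_id_gaussianReal (μ := 0) (v := Real.toNNReal (ε ^ 2)) 2).ofReal_variance_eq
  simp only [id_eq, integral_id_gaussianReal, sub_zero] at h1
  rw [← h1, ← h2, variance_id_gaussianReal, Real.coe_toNNReal _ (sq_nonneg ε)]

/-- Markov's inequality for the squared norm of a Gaussian array. -/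
lemma pi_sum_sq_le {ι : Type*} [Fintype ι] {ε R : ℝ} (hR : 0 < R) :
    Measure.pi (fun _ : ι => gaussianReal 0 (Real.toNNReal (ε ^ 2))) {x | R ≤ ∑ i, x i ^ 2}
      ≤ ENNReal.ofReal (Fintype.card ι * ε ^ 2 / R) := by
  set μ := Measure.pi (fun _ : ι => gaussianReal 0 (Real.toNNReal (ε ^ 2)))
  have h1 : ∫⁻ x, ENNReal.ofReal (∑ i, x i ^ 2) ∂μ = ENNReal.ofReal (Fintype.card ι * ε ^ 2) := by
    simp only [ENNReal.ofReal_sum_of_nonneg fun i _ => sq_nonneg _]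
    rw [lintegral_finsetSum _ fun i _ => by fun_prop]
    have : ∀ i, ∫⁻ x, ENNReal.ofReal (x i ^ 2) ∂μ = ENNReal.ofReal (ε ^ 2) := fun i => by
      rw [← lintegral_sq_gaussianReal]
      exact (measurePreserving_eval (fun _ : ι => gaussianReal 0 (Real.toNNReal (ε ^ 2)))
        i).lintegral_comp (f := fun x => ENNReal.ofReal (x ^ 2)) (by fun_prop)
    rw [Finset.sum_congr rfl fun i _ => this i, Finset.sum_const, Finset.card_univ, nsmul_eq_mul,
      ENNReal.ofReal_mul (Nat.cast_nonneg _), ENNReal.ofReal_natCast]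
  have h2 := meas_ge_le_lintegral_div (μ := μ) (f := fun x => ENNReal.ofReal (∑ i, x i ^ 2))
    (Measurable.aemeasurable (by fun_prop)) (ε := ENNReal.ofReal R) (by simpa using hR) ENNReal.ofReal_ne_top
  rw [h1, ← ENNReal.ofReal_div_of_pos hR] at h2
  refine le_trans (measure_mono fun x hx => ?_) h2
  exact ENNReal.ofReal_le_ofReal hx

lemma BelowBy.smul {A : Matrix (Fin m) (Fin n) ℝ} {s c : ℝ} (hc : 0 ≤ c) (h : BelowBy A s) :
    BelowBy (c • A) (c * s) := fun k X => by
  rw [Matrix.smul_mul, norm_smul, Real.norm_of_nonneg hc, mul_assoc]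
  exact mul_le_mul_of_nonneg_left (h k X) hc

/-- This is the condition on `M` in the slab argument. The block `Φᵀ` alone preserves lengths and
the other block only adds to them. -/
lemma dotProduct_self_le_vecMul_fromCols {Φ : Matrix (Fin m) (Fin d) ℝ} (hΦ : Φᵀ * Φ = 1)
    (Ψ : Matrix (Fin n) (Fin d) ℝ) (w : Fin d → ℝ) :
    w ⬝ᵥ w ≤ (w ᵥ* Matrix.fromCols Φᵀ Ψᵀ) ⬝ᵥ (w ᵥ* Matrix.fromCols Φᵀ Ψᵀ) := by
  rw [Matrix.vecMul_fromCols, sumElim_dotProduct_sumElim]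
  have h1 : (w ᵥ* Φᵀ) ⬝ᵥ (w ᵥ* Φᵀ) = w ⬝ᵥ w := by
    rw [Matrix.vecMul_transpose, Matrix.dotProduct_mulVec, ← Matrix.mulVec_transpose,
      Matrix.mulVec_mulVec, hΦ, Matrix.one_mulVec]
  have h2 : 0 ≤ (w ᵥ* Ψᵀ) ⬝ᵥ (w ᵥ* Ψᵀ) := Finset.sum_nonneg fun i _ => mul_self_nonneg _
  linarith

/-- The right-hand side is twice the half sum, which is why `gaussianInit_good` takes the threshold
`2 * s` in `nearKernel`. -/
lemma mulArray_stack (Φ : Matrix (Fin m) (Fin d) ℝ) (Ψ : Matrix (Fin n) (Fin d) ℝ)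
    (W : (Fin m → Fin d → ℝ) × (Fin n → Fin d → ℝ)) :
    mulArray (Matrix.fromCols Φᵀ Ψᵀ) (stack W) = Φᵀ * Matrix.of W.1 + Ψᵀ * Matrix.of W.2 := by
  ext k j
  simp [mulArray, Matrix.mul_apply, stack]

lemma sum_stack_sq (W : (Fin m → Fin d → ℝ) × (Fin n → Fin d → ℝ)) :
    ∑ z, stack W z ^ 2 = ‖(Matrix.of W.1 : Matrix (Fin m) (Fin d) ℝ)‖ ^ 2
      + ‖(Matrix.of W.2 : Matrix (Fin n) (Fin d) ℝ)‖ ^ 2 := by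
  simp only [norm_sq_eq_sum, Fintype.sum_prod_type, Fintype.sum_sum_type, stack, Sum.elim_inl,
    Sum.elim_inr, Matrix.of_apply]

/-- With probability at least `1 - ρ`, the Gaussian initialization is small and its half sum in
singular coordinates is well conditioned. -/
theorem gaussianInit_good {Φ : Matrix (Fin m) (Fin d) ℝ} {Ψ : Matrix (Fin n) (Fin d) ℝ}
    (hΦ : Φᵀ * Φ = 1) {ε ρ R s : ℝ} (hε : 0 < ε) (hR : 0 < R) (hs : 0 ≤ s)
    (hRρ : ((m : ℝ) + n) * d * ε ^ 2 / R ≤ ρ / 2)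
    (hsρ : d * (2 * s * Real.sqrt (d * ((m : ℝ) + n)) / ε) ≤ ρ / 2) :
    ENNReal.ofReal (1 - ρ) ≤ gaussianInit m n d ε
      {W | ‖(Matrix.of W.1 : Matrix (Fin m) (Fin d) ℝ)‖ ^ 2
          + ‖(Matrix.of W.2 : Matrix (Fin n) (Fin d) ℝ)‖ ^ 2 ≤ R ∧
        BelowBy (halfSum Φ Ψ (Matrix.of W.1, Matrix.of W.2)) s} := by
  set M := Matrix.fromCols Φᵀ Ψᵀ with hM
  set μ := Measure.pi fun _ : (Fin m ⊕ Fin n) × Fin d => gaussianReal 0 (Real.toNNReal (ε ^ 2))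
  set bad : Set ((Fin m ⊕ Fin n) × Fin d → ℝ) :=
    {x | R ≤ ∑ z, x z ^ 2} ∪ ⋃ j, nearKernel M (2 * s) j with hbad
  have hcard : (Fintype.card (Fin m ⊕ Fin n) : ℝ) = (m : ℝ) + n := by simp
  have hmeas : MeasurableSet bad :=
    (measurableSet_le measurable_const (by fun_prop)).union
      (MeasurableSet.iUnion fun j => (isClosed_nearKernel M (2 * s) j).measurableSet)
  have hbadle : μ bad ≤ ENNReal.ofReal ρ := by
    have h1 : μ {x | R ≤ ∑ z, x z ^ 2} ≤ ENNReal.ofReal (ρ / 2) := by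
      refine (pi_sum_sq_le hR).trans (ENNReal.ofReal_le_ofReal ?_)
      rw [Fintype.card_prod, Nat.cast_mul, hcard, Fintype.card_fin]
      exact hRρ
    have h2 : μ (⋃ j, nearKernel M (2 * s) j) ≤ ENNReal.ofReal (ρ / 2) := by
      calc _ ≤ ∑ j, μ (nearKernel M (2 * s) j) := measure_iUnion_fintype_le _ _
        _ ≤ ∑ _j : Fin d, ENNReal.ofReal (2 * s * Real.sqrt (d * ((m : ℝ) + n)) / ε) := by
            refine Finset.sum_le_sum fun j _ => ?_
            rw [← hcard]
            exact pi_nearKernel_le M (dotProduct_self_le_vecMul_fromCols hΦ Ψ) (by positivity) hε j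
        _ = ENNReal.ofReal (d * (2 * s * Real.sqrt (d * ((m : ℝ) + n)) / ε)) := by
            rw [Finset.sum_const, Finset.card_univ, Fintype.card_fin, nsmul_eq_mul,
              ENNReal.ofReal_mul (Nat.cast_nonneg _), ENNReal.ofReal_natCast]
        _ ≤ _ := ENNReal.ofReal_le_ofReal hsρ
    have hρ : 0 ≤ ρ / 2 := le_trans (by positivity) hsρ
    calc μ bad ≤ _ := measure_union_le _ _
      _ ≤ ENNReal.ofReal (ρ / 2) + ENNReal.ofReal (ρ / 2) := add_le_add h1 h2
      _ = ENNReal.ofReal ρ := by rw [← ENNReal.ofReal_add hρ hρ, add_halves]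
  have hgood : ENNReal.ofReal (1 - ρ) ≤ μ badᶜ := by
    have hρ : 0 ≤ ρ := by
      have : 0 ≤ ρ / 2 := le_trans (by positivity) hsρ
      linarith
    rw [prob_compl_eq_one_sub hmeas, ENNReal.ofReal_sub _ hρ, ENNReal.ofReal_one]
    exact tsub_le_tsub_left hbadle _
  rw [← (measurePreserving_stack ε).measure_preimage hmeas.compl.nullMeasurableSet] at hgood
  refine hgood.trans (measure_mono fun W hW => ?_)
  have hW' : stack W ∉ bad := hW
  rw [hbad, Set.mem_union, not_or, Set.mem_iUnion, not_exists] at hW'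
  refine ⟨?_, ?_⟩
  · have h1 : ¬ R ≤ ∑ z, stack W z ^ 2 := hW'.1
    rw [sum_stack_sq] at h1
    exact (not_le.mp h1).le
  · have h1 := (belowBy_mulArray M hW'.2).smul (by norm_num : (0 : ℝ) ≤ 1 / 2)
    rw [hM, mulArray_stack] at h1
    exact h1.mono (by linarith)

end Initialization

end MatFac

namespace MatFac

open scoped Matrix.Norms.Frobenius

/-! ### Verification of the smallness conditions. -/

section Constants

set_option maxHeartbeats 800000 in
/-- The smallness conditions hold for initial size `ε` and step size `η` as in the main theorem. -/
lemma smallParams_of_le {d : ℕ} {N σ₁ σd ε η ρ : ℝ} (hρ : 0 < ρ) (hρ1 : ρ < 1)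
    (hd : 1 ≤ (d : ℝ)) (hdN : (d : ℝ) ≤ N) (hσd : 0 < σd) (hσ : σd ≤ σ₁) (hε : 0 < ε)
    (hεle : ε ^ 2 * (d ^ 3 * N ^ 2 * σ₁) ≤ (ρ ^ 2 / 2000) ^ 2 * σd ^ 2) (hη : 0 < η)
    (hηle : η * (d * σ₁ ^ 3) ≤ 1 / 2 * (σd * ε ^ 2)) :
    SmallParams d σ₁ σd η (Real.sqrt (2 * (N * d * ε ^ 2) / ρ))
      (ρ * ε / (4 * d * Real.sqrt (d * N))) (Real.sqrt (5 * (d * σ₁))) := by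
  have hσ₁ : 0 < σ₁ := hσd.trans_le hσ
  have hN : 1 ≤ N := hd.trans hdN
  have hd0 : (0 : ℝ) < d := by linarith
  have hN0 : 0 < N := by linarith
  have hρ4 : ρ ^ 4 ≤ 1 := pow_le_one₀ hρ.le hρ1.le
  have hρ4' : ρ ^ 4 ≤ ρ := by
    calc ρ ^ 4 ≤ ρ ^ 1 := pow_le_pow_of_le_one hρ.le hρ1.le (by norm_num)
      _ = ρ := pow_one _
  -- `Y = ε² d³ N²` is at most `ρ⁴ σd / 4000000`
  set Y := ε ^ 2 * (d ^ 3 * N ^ 2) with hY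
  have hY0 : 0 < Y := by positivity
  have hYσ : Y * σ₁ ≤ ρ ^ 4 / 4000000 * σd ^ 2 := by
    calc Y * σ₁ = ε ^ 2 * (d ^ 3 * N ^ 2 * σ₁) := by rw [hY]; ring
      _ ≤ _ := hεle
      _ = _ := by ring
  have hY1 : Y ≤ ρ ^ 4 / 4000000 * σd := by
    have : Y * σd ≤ ρ ^ 4 / 4000000 * σd * σd := by
      calc Y * σd ≤ Y * σ₁ := by gcongr
        _ ≤ _ := hYσ
        _ = _ := by ring
    exact le_of_mul_le_mul_right this hσd
  have hdd : (1 : ℝ) ≤ d ^ 2 := one_le_pow₀ hd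
  have hE1 : N * d * ε ^ 2 ≤ Y := by
    have : N * d ≤ d ^ 3 * N ^ 2 := by
      calc N * d = (N * d) * 1 := by ring
        _ ≤ (N * d) * (d ^ 2 * N) := by gcongr; nlinarith
        _ = _ := by ring
    rw [hY, mul_comm]; gcongr
  have hr2 : Real.sqrt (2 * (N * d * ε ^ 2) / ρ) ^ 2 = 2 * (N * d * ε ^ 2) / ρ :=
    Real.sq_sqrt (by positivity)
  have hl2 : Real.sqrt (5 * (d * σ₁)) ^ 2 = 5 * (d * σ₁) := Real.sq_sqrt (by positivity)
  have hw2 : Real.sqrt (d * N) ^ 2 = d * N := Real.sq_sqrt (by positivity)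
  have hs2 : (ρ * ε / (4 * d * Real.sqrt (d * N))) ^ 2 = ρ ^ 2 * ε ^ 2 / (16 * (d ^ 3 * N)) := by
    rw [div_pow, mul_pow, mul_pow, mul_pow, hw2]; ring
  set r := Real.sqrt (2 * (N * d * ε ^ 2) / ρ) with hr
  set l := Real.sqrt (5 * (d * σ₁)) with hl
  set s := ρ * ε / (4 * d * Real.sqrt (d * N)) with hs
  have hr0 : 0 ≤ r := Real.sqrt_nonneg _
  have hl0 : 0 ≤ l := Real.sqrt_nonneg _
  have hs0 : 0 < s := by rw [hs]; positivity
  -- `r²` is the Markov threshold for failure probability `ρ/2`, and `s` makes the union bound over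
  -- the `d` columns equal to `ρ/2`.
  refine ⟨hη, hr0, hs0, hσd, hσ, hd, hl0, hl2, ?_, ?_, ?_, ?_, ?_, ?_, ?_⟩
  · rw [hr2, ← mul_div_assoc, div_le_iff₀ hρ]
    have h2 := mul_le_mul_of_nonneg_right hρ4' hσd.le
    have h3 := mul_pos hρ hσd
    linarith
  · refine le_of_sq_le_sq ?_ hσd.le
    rw [mul_pow, mul_pow, hr2, hl2]
    have h1 : N * d * ε ^ 2 * (d * σ₁) ≤ Y * σ₁ := by
      rw [hY]
      have : N * d * d ≤ d ^ 3 * N ^ 2 := by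
        calc N * d * d = (N * d ^ 2) * 1 := by ring
          _ ≤ (N * d ^ 2) * (d * N) := by gcongr; nlinarith
          _ = _ := by ring
      have := mul_le_mul_of_nonneg_left this (by positivity : 0 ≤ ε ^ 2 * σ₁)
      linarith
    have h3 : 3 ^ 2 * (5 * (d * σ₁) * (2 * (N * d * ε ^ 2) / ρ))
        = 90 * (N * d * ε ^ 2 * (d * σ₁)) / ρ := by ring
    rw [h3, div_le_iff₀ hρ]
    have h4 := mul_le_mul_of_nonneg_right hρ4' (sq_nonneg σd)
    have h5 := mul_nonneg hρ.le (sq_nonneg σd)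
    linarith
  -- Squared and cleared of denominators, the condition on `r³` reads `18432 Y² ≤ ρ⁵ σd²`; this is
  -- where the powers `d³ N²` in the bound on `ε²` are needed.
  · refine le_of_sq_le_sq ?_ (by positivity)
    have h0 : (12 * r ^ 3) ^ 2 = 144 * (r ^ 2) ^ 3 := by ring
    rw [h0, hr2, mul_pow, hs2, div_pow, mul_div_assoc', mul_div_assoc',
      div_le_div_iff₀ (by positivity) (by positivity)]
    have h1 : Y ^ 2 ≤ ρ ^ 5 / 20000 * σd ^ 2 := by
      calc Y ^ 2 ≤ (ρ ^ 4 / 4000000 * σd) ^ 2 := by gcongr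
        _ = (ρ ^ 3 * ρ ^ 5) / 16000000000000 * σd ^ 2 := by ring
        _ ≤ (1 * ρ ^ 5) / 20000 * σd ^ 2 := by
            gcongr
            · exact pow_le_one₀ hρ.le hρ1.le
            · norm_num
        _ = _ := by ring
    calc 144 * (2 * (N * d * ε ^ 2)) ^ 3 * (16 * (d ^ 3 * N)) = 18432 * Y ^ 2 * ε ^ 2 := by
          rw [hY]; ring
      _ ≤ 18432 * (ρ ^ 5 / 20000 * σd ^ 2) * ε ^ 2 := by gcongr
      _ ≤ 20000 * (ρ ^ 5 / 20000 * σd ^ 2) * ε ^ 2 := by gcongr; norm_num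
      _ = _ := by ring
  · refine le_of_sq_le_sq ?_ (by positivity)
    have h0 : (40 * (η * (σ₁ * l ^ 3))) ^ 2 = 1600 * η ^ 2 * σ₁ ^ 2 * (l ^ 2) ^ 3 := by ring
    rw [h0, hl2, mul_pow σd, hs2, mul_div_assoc', le_div_iff₀ (by positivity)]
    have h1 : (η * (d * σ₁ ^ 3)) ^ 2 ≤ (1 / 2 * (σd * ε ^ 2)) ^ 2 := by gcongr
    have h2 : ε ^ 2 * (d ^ 4 * N) ≤ Y := by
      rw [hY]
      have : (d : ℝ) ^ 4 * N ≤ d ^ 3 * N ^ 2 := by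
        calc (d : ℝ) ^ 4 * N = (d ^ 3 * N) * d := by ring
          _ ≤ (d ^ 3 * N) * N := by gcongr
          _ = _ := by ring
      gcongr
    have h3 : ρ ^ 4 ≤ ρ ^ 2 := pow_le_pow_of_le_one hρ.le hρ1.le (by norm_num)
    have h4 : 800000 * Y ≤ ρ ^ 2 * σ₁ := by
      have := mul_le_mul h3 hσ hσd.le (by positivity)
      have h5 := mul_pos (pow_pos hρ 2) hσ₁
      linarith
    refine le_of_mul_le_mul_right ?_ hσ₁
    calc 1600 * η ^ 2 * σ₁ ^ 2 * (5 * (d * σ₁)) ^ 3 * (16 * (d ^ 3 * N)) * σ₁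
        = 3200000 * (η * (d * σ₁ ^ 3)) ^ 2 * (d ^ 4 * N) := by ring
      _ ≤ 3200000 * (1 / 2 * (σd * ε ^ 2)) ^ 2 * (d ^ 4 * N) := by gcongr
      _ = σd ^ 2 * ε ^ 2 * (800000 * (ε ^ 2 * (d ^ 4 * N))) := by ring
      _ ≤ σd ^ 2 * ε ^ 2 * (800000 * Y) := by gcongr
      _ ≤ σd ^ 2 * ε ^ 2 * (ρ ^ 2 * σ₁) := by gcongr
      _ = _ := by ring
  · rw [hr2, le_div_iff₀ hρ]
    have h1 : η * (d * σ₁ ^ 2) ≤ 1 / 2 * ε ^ 2 := by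
      refine le_of_mul_le_mul_right ?_ hσ₁
      calc η * (d * σ₁ ^ 2) * σ₁ = η * (d * σ₁ ^ 3) := by ring
        _ ≤ 1 / 2 * (σd * ε ^ 2) := hηle
        _ ≤ 1 / 2 * (σ₁ * ε ^ 2) := by gcongr
        _ = _ := by ring
    have h2 : ε ^ 2 ≤ N * d * ε ^ 2 := le_mul_of_one_le_left (sq_nonneg _) (by nlinarith)
    have h3 : 4 * (η * (d * σ₁ ^ 2)) * ρ ≤ 4 * (η * (d * σ₁ ^ 2)) * 1 := by gcongr
    linarith
  · rw [hl2]
    have h1 : d * ε ^ 2 ≤ Y := by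
      refine le_trans ?_ hE1
      have : (d : ℝ) ≤ N * d := by nlinarith
      gcongr
    have h2 : 100 * Y ≤ σ₁ := by
      have : ρ ^ 4 / 4000000 * σd ≤ 1 / 4000000 * σ₁ := by gcongr
      linarith
    refine le_of_mul_le_mul_right ?_ hσ₁
    calc 8 * (η * (5 * (d * σ₁)) ^ 2) * σ₁ = 200 * d * (η * (d * σ₁ ^ 3)) := by ring
      _ ≤ 200 * d * (1 / 2 * (σd * ε ^ 2)) := by gcongr
      _ = σd * (100 * (d * ε ^ 2)) := by ring
      _ ≤ σd * (100 * Y) := by gcongr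
      _ ≤ σd * σ₁ := by gcongr
  · rw [hs2, mul_div_assoc', div_le_iff₀ (by positivity)]
    have h1 : ε ^ 2 ≤ N * d * ε ^ 2 := le_mul_of_one_le_left (sq_nonneg _) (by nlinarith)
    have h2 : ε ^ 2 ≤ σd := by
      have : ρ ^ 4 / 4000000 * σd ≤ 1 / 4000000 * σd := by gcongr
      linarith
    have h3 : ρ ^ 2 ≤ 1 := pow_le_one₀ hρ.le hρ1.le
    have h4 : 1 ≤ (d : ℝ) ^ 3 * N := by nlinarith [one_le_pow₀ hd (n := 3)]
    calc 16 * (ρ ^ 2 * ε ^ 2) ≤ 16 * (1 * σd) := by gcongr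
      _ = σd * (16 * 1) := by ring
      _ ≤ _ := by gcongr

end Constants

/-! ### Exponential comparison of geometric rates. -/

section Rates

/-- On `[0, 1]`, `e^(x/2) (1 - x/2) ≤ 1 ≤ (1 + x)(1 - x/2)`. -/
lemma exp_le_one_add_pow {x : ℝ} (hx : 0 ≤ x) (hx1 : x ≤ 1) (t : ℕ) :
    Real.exp (t * (x / 2)) ≤ (1 + x) ^ t := by
  rw [Real.exp_nat_mul]
  refine pow_le_pow_left₀ (Real.exp_pos _).le ?_ t
  have h1 := Real.add_one_le_exp (-(x / 2))
  have h2 : Real.exp (x / 2) * Real.exp (-(x / 2)) = 1 := by rw [← Real.exp_add]; simp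
  have h3 := Real.exp_pos (x / 2)
  have h4 : Real.exp (x / 2) * (1 - x / 2) ≤ 1 := by
    rw [← h2]; gcongr; linarith
  nlinarith

lemma one_sub_pow_le_exp {x : ℝ} (hx1 : x ≤ 1) (t : ℕ) :
    (1 - x) ^ t ≤ Real.exp (-(t * x)) := by
  have h1 : Real.exp (-(t * x)) = Real.exp (-x) ^ t := by rw [← Real.exp_nat_mul]; ring_nf
  rw [h1]
  exact pow_le_pow_left₀ (by linarith) (by linarith [Real.add_one_le_exp (-x)]) t

end Rates

/-! ### Counting iterations in the two phases. -/

section Main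

open MeasureTheory ProbabilityTheory

/-- Two-phase bound on the number of iterations: growth of the half sum, then linear
convergence. -/
lemma loss_le_of_lt {m n d : ℕ} {S : Matrix (Fin m) (Fin n) ℝ} {Φ : Matrix (Fin m) (Fin d) ℝ}
    {Ψ : Matrix (Fin n) (Fin d) ℝ} {H : Matrix (Fin d) (Fin d) ℝ} {σ₁ σd η r s₀ l Z δ : ℝ}
    {W : Matrix (Fin m) (Fin d) ℝ × Matrix (Fin n) (Fin d) ℝ}
    (h : IsThinSVD S Φ Ψ H σ₁ σd) (hp : SmallParams d σ₁ σd η r s₀ l)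
    (hU : ‖W.1‖ ^ 2 + ‖W.2‖ ^ 2 ≤ r ^ 2) (hA : BelowBy (halfSum Φ Ψ W) s₀)
    (hZ : Real.exp 1 ≤ Z) (hZs : Real.sqrt σd / 4 ≤ Z * s₀)
    (hZσ : 5 * (d * σ₁ ^ 2) ≤ Z ^ 2 * σd ^ 2) (hδ : 0 < δ) {t : ℕ}
    (ht : 600 * (1 / (η * σd) * Real.log Z + 1 / (η * σd) * max 0 (Real.log (σd ^ 2 / δ)))
      < t) :
    loss S (gdIter S η W t).1 (gdIter S η W t).2 ≤ δ := by
  have hη := hp.step_pos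
  have hσd := hp.σd_pos
  have hx : 0 < η * σd := by positivity
  have hx8 := hp.step_mul_σd
  have hZ0 : 0 < Z := (Real.exp_pos 1).trans_le hZ
  set Λ := Real.log Z with hΛ
  set D := max 0 (Real.log (σd ^ 2 / δ)) with hD
  have hΛ1 : 1 ≤ Λ := by rw [hΛ, Real.le_log_iff_exp_le hZ0]; exact hZ
  have hD0 : 0 ≤ D := le_max_left _ _
  have ht' : 600 * (Λ + D) < t * (η * σd) := by
    have h1 : 600 * (1 / (η * σd) * Λ + 1 / (η * σd) * D) = 600 * (Λ + D) / (η * σd) := by ring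
    rw [h1, div_lt_iff₀ hx] at ht
    exact ht
  -- The half sum gains at least `e^(ησd/8)` per step, so it has grown by a factor `Z = e^Λ` after
  -- `t₁` steps.
  set t₁ := ⌈8 * Λ / (η * σd)⌉₊ with ht₁
  have ht₁l : 8 * Λ ≤ t₁ * (η * σd) := by
    have := Nat.le_ceil (8 * Λ / (η * σd))
    rwa [div_le_iff₀ hx] at this
  have ht₁u : t₁ * (η * σd) ≤ 8 * Λ + 1 := by
    have := (Nat.ceil_lt_add_one (by positivity : 0 ≤ 8 * Λ / (η * σd))).le
    calc t₁ * (η * σd) ≤ (8 * Λ / (η * σd) + 1) * (η * σd) := by gcongr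
      _ = 8 * Λ + η * σd := by field_simp
      _ ≤ _ := by linarith
  have hle : t₁ ≤ t := by
    have : (t₁ : ℝ) * (η * σd) ≤ t * (η * σd) := by linarith
    exact_mod_cast le_of_mul_le_mul_right this hx
  obtain ⟨u, rfl⟩ := Nat.exists_eq_add_of_le hle
  have hgrow : Real.sqrt σd / 4 ≤ (1 + η * σd / 4) ^ t₁ * s₀ := by
    refine hZs.trans (mul_le_mul_of_nonneg_right ?_ hp.s_pos.le)
    refine le_trans ?_ (exp_le_one_add_pow (by positivity) (by linarith) t₁)
    rw [← Real.exp_log hZ0]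
    refine Real.exp_le_exp.mpr ?_
    rw [← hΛ]
    linarith
  -- Since `Λ ≥ 1`, the first phase uses at most `9Λ` of `600(Λ + D)`. What remains yields the decay
  -- `e^(-(2Λ + D))`: `Z⁻²` cancels the initial potential and `e^(-D)` reaches `δ`.
  have hu : 256 * (2 * Λ + D) ≤ u * (η * σd) := by
    push_cast at ht'
    linarith
  refine (loss_gdIter_le h hp h.norm_sq_le hU hA hgrow u).trans ?_
  have h1 := one_sub_pow_le_exp (by linarith : η * σd / 256 ≤ 1) u
  have h2 : Real.exp (-(u * (η * σd / 256))) ≤ Real.exp (-(2 * Λ + D)) :=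
    Real.exp_le_exp.mpr (by linarith)
  have h3 : Real.exp (-(2 * Λ + D)) = (Z ^ 2)⁻¹ * Real.exp (-D) := by
    have : -(2 * Λ + D) = -(Λ + Λ) + -D := by ring
    rw [this, Real.exp_add, Real.exp_neg, Real.exp_add, hΛ, Real.exp_log hZ0, sq]
  have h4 : σd ^ 2 * Real.exp (-D) ≤ δ := by
    have e1 : Real.log (σd ^ 2 / δ) ≤ D := le_max_right _ _
    rw [Real.log_le_iff_le_exp (by positivity), div_le_iff₀ hδ] at e1
    have e2 : Real.exp D * Real.exp (-D) = 1 := by rw [← Real.exp_add]; simp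
    calc σd ^ 2 * Real.exp (-D) ≤ Real.exp D * δ * Real.exp (-D) := by gcongr
      _ = δ * (Real.exp D * Real.exp (-D)) := by ring
      _ = δ := by rw [e2, mul_one]
  have hd := hp.d_pos
  calc 5 * (d * σ₁ ^ 2) * (1 - η * σd / 256) ^ u
      ≤ (Z ^ 2 * σd ^ 2) * ((Z ^ 2)⁻¹ * Real.exp (-D)) := by
        refine mul_le_mul hZσ (h1.trans (h2.trans h3.le)) ?_ (by positivity)
        exact pow_nonneg (by linarith) u
    _ = σd ^ 2 * Real.exp (-D) := by field_simp
    _ ≤ δ := h4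

end Main

end MatFac

end

/-! ### The main theorem: choice of constants. -/

set_option maxHeartbeats 800000 in
theorem theorem1 :
    ∃ (k : ℕ) (C : ℝ), 0 < C ∧
    ∀ ρ : ℝ, 0 < ρ → ρ < 1 →
    ∃ (c₁ c₂ : ℝ), 0 < c₁ ∧ 0 < c₂ ∧
    ∀ (m n d : ℕ) (S : Matrix (Fin m) (Fin n) ℝ), 0 < d → S.rank = d →
    ∀ σ₁ σd : ℝ, σ₁ = MatFac.sval S 0 → σd = MatFac.sval S (d - 1) →
    ∀ ε : ℝ, 0 < ε →
      ε ≤ c₁ * (σd / (Real.sqrt ((d : ℝ) ^ 3 * σ₁) * ((m : ℝ) + n))) /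
        Real.log (((m : ℝ) + n) * (σ₁ / σd)) ^ k →
    ∃ T : ℝ → ℝ → ℝ, ∀ δ η : ℝ, 0 < δ → 0 < η →
      η ≤ c₂ * (σd * ε ^ 2 / ((d : ℝ) * σ₁ ^ 3)) →
      T δ η ≤ C * (1 / (η * σd) * Real.log ((d : ℝ) * σd / ε ^ 2)
          + 1 / (η * σd) * max 0 (Real.log (σd ^ 2 / δ))) ∧
      (δ ≤ min σd (σd ^ 2) →
        T δ η ≤ C * (1 / (η * σd) * Real.log ((d : ℝ) * σd / ε)
          + 1 / (η * σd) * Real.log (σd / δ))) ∧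
      ENNReal.ofReal (1 - ρ) ≤
        MatFac.gaussianInit m n d ε
          {W | ∀ t : ℕ, T δ η < (t : ℝ) →
            MatFac.loss S
              (MatFac.gdIter S η (Matrix.of W.1, Matrix.of W.2) t).1
              (MatFac.gdIter S η (Matrix.of W.1, Matrix.of W.2) t).2 ≤ δ} := by
  refine ⟨1, 1200, by norm_num, fun ρ hρ hρ1 => ⟨ρ ^ 2 / 4000, 1 / 2, by positivity, by norm_num,
    fun m n d S hd hrank σ₁ σd hσ₁ hσd ε hε hεle => ?_⟩⟩
  obtain ⟨Φ, Ψ, H, hsvd⟩ := MatFac.exists_isThinSVD S hrank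
  rw [← hσ₁, ← hσd] at hsvd
  have hσd0 : 0 < σd := by rw [hσd]; exact MatFac.sval_pos (by omega)
  have hσ : σd ≤ σ₁ := by
    rw [hσd, hσ₁]; exact LinearMap.singularValues_antitone _ (Nat.zero_le _)
  have hσ₁0 : 0 < σ₁ := hσd0.trans_le hσ
  have hd1 : (1 : ℝ) ≤ d := by exact_mod_cast hd
  have hdm : (d : ℝ) ≤ m := by
    have := Matrix.rank_le_height S
    rw [hrank] at this
    exact_mod_cast this
  have hdn : (d : ℝ) ≤ n := by
    have := Matrix.rank_le_width S
    rw [hrank] at this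
    exact_mod_cast this
  set N : ℝ := (m : ℝ) + n with hN
  have hdN : (d : ℝ) ≤ N := by linarith
  have hN2 : 2 ≤ N := by linarith
  -- The logarithm enters only through the bound `≥ 1/2`, which costs the factor between `ρ²/4000`
  -- and `ρ²/2000`.
  have hsq : ε ^ 2 * (d ^ 3 * N ^ 2 * σ₁) ≤ (ρ ^ 2 / 2000) ^ 2 * σd ^ 2 := by
    have hlog : 1 / 2 ≤ Real.log (N * (σ₁ / σd)) := by
      have h1 : 1 ≤ σ₁ / σd := (one_le_div hσd0).mpr hσ
      have h2 : Real.log 2 ≤ Real.log (N * (σ₁ / σd)) :=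
        Real.log_le_log (by norm_num) (by nlinarith)
      linarith [Real.log_two_gt_d9]
    have hw : 0 < Real.sqrt ((d : ℝ) ^ 3 * σ₁) := Real.sqrt_pos.mpr (by positivity)
    rw [pow_one, le_div_iff₀ (by linarith), ← mul_div_assoc (ρ ^ 2 / 4000) σd,
      le_div_iff₀ (by positivity)] at hεle
    have h1 : ε * (Real.sqrt ((d : ℝ) ^ 3 * σ₁) * N) ≤ ρ ^ 2 / 2000 * σd := by
      have h0 : 0 ≤ ε * (Real.sqrt ((d : ℝ) ^ 3 * σ₁) * N) := by positivity
      have := mul_le_mul_of_nonneg_left hlog h0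
      linarith
    have h2 := pow_le_pow_left₀ (by positivity) h1 2
    rw [mul_pow, mul_pow, Real.sq_sqrt (by positivity), mul_pow] at h2
    linarith
  -- `Z` controls both phases: it dominates the required growth `√σd / (4 s₀)`, and `Z² σd²`
  -- dominates the initial potential `5 d σ₁²`.
  set Z := (d : ℝ) * σd / ε ^ 2 with hZdef
  have hZ0 : 0 < Z := by positivity
  -- the initialization scale is tiny compared with `σd`
  have hεN : ε ^ 2 * (d ^ 3 * N ^ 2) * σ₁ ≤ ρ ^ 4 / 4000000 * σd * σd := by linarith
  have hρ4 : ρ ^ 4 ≤ 1 := pow_le_one₀ hρ.le hρ1.le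
  have hdN2 : d * N ≤ d ^ 3 * N ^ 2 := by
    have h1 : (1 : ℝ) ≤ d ^ 2 * N := by nlinarith
    calc (d : ℝ) * N = d * N * 1 := by ring
      _ ≤ d * N * (d ^ 2 * N) := by gcongr
      _ = _ := by ring
  have hεdN : ε ^ 2 * (d * N) * σ₁ ≤ ρ ^ 4 / 4000000 * σd * σd := by
    refine le_trans ?_ hεN
    gcongr
  have hZκ : 5 * (d * σ₁) ≤ Z * σd := by
    rw [hZdef, div_mul_eq_mul_div, le_div_iff₀ (by positivity)]
    have h1 : ε ^ 2 * 1 * σ₁ ≤ ε ^ 2 * (d * N) * σ₁ := by gcongr; nlinarith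
    have h2 : ρ ^ 4 / 4000000 * σd * σd ≤ 1 / 4000000 * σd * σd := by gcongr
    have h3 : 5 * (ε ^ 2 * σ₁) ≤ σd * σd := by nlinarith
    have := mul_le_mul_of_nonneg_left h3 (by linarith : (0 : ℝ) ≤ d)
    linarith
  have hZ5 : 5 ≤ Z := by
    have : 5 * σd ≤ Z * σd := le_trans (by nlinarith) hZκ
    exact le_of_mul_le_mul_right this hσd0
  have hZe : Real.exp 1 ≤ Z := by linarith [Real.exp_one_lt_d9]
  have hΛ : 0 ≤ Real.log Z := Real.log_nonneg (by linarith)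
  refine ⟨fun δ η => 600 * (1 / (η * σd) * Real.log Z
    + 1 / (η * σd) * max 0 (Real.log (σd ^ 2 / δ))), fun δ η hδ hη hηle => ⟨?_, ?_, ?_⟩⟩
  · have h1 : 0 ≤ 1 / (η * σd) * Real.log Z := by positivity
    have h2 : 0 ≤ 1 / (η * σd) * max 0 (Real.log (σd ^ 2 / δ)) := by positivity
    dsimp only
    linarith
  · intro hδle
    have hδ1 : δ ≤ σd := hδle.trans (min_le_left _ _)
    have hδ2 : δ ≤ σd ^ 2 := hδle.trans (min_le_right _ _)
    have hmax : max 0 (Real.log (σd ^ 2 / δ)) = Real.log (σd ^ 2 / δ) :=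
      max_eq_right (Real.log_nonneg ((one_le_div hδ).mpr hδ2))
    have hd0 : (d : ℝ) ≠ 0 := by positivity
    have e1 : Real.log Z = Real.log d + Real.log σd - 2 * Real.log ε := by
      rw [hZdef, Real.log_div (by positivity) (by positivity), Real.log_mul hd0 hσd0.ne',
        Real.log_pow]
      norm_num
    have e2 : Real.log (σd ^ 2 / δ) = 2 * Real.log σd - Real.log δ := by
      rw [Real.log_div (by positivity) hδ.ne', Real.log_pow]; norm_num
    have e3 : Real.log (d * σd / ε) = Real.log d + Real.log σd - Real.log ε := by
      rw [Real.log_div (by positivity) hε.ne', Real.log_mul hd0 hσd0.ne']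
    have e4 : Real.log (σd / δ) = Real.log σd - Real.log δ := Real.log_div hσd0.ne' hδ.ne'
    have e5 : Real.log δ ≤ Real.log σd := Real.log_le_log hδ hδ1
    have e6 : 0 ≤ Real.log d := Real.log_nonneg hd1
    -- The two sides differ by `log d + log (σd / δ) ≥ 0`. The factor `2` turns the `600` in `T`
    -- into `C = 1200`.
    have key : Real.log Z + Real.log (σd ^ 2 / δ)
        ≤ 2 * (Real.log (d * σd / ε) + Real.log (σd / δ)) := by
      rw [e1, e2, e3, e4]; linarith
    have := mul_le_mul_of_nonneg_left key (by positivity : 0 ≤ 1 / (η * σd))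
    dsimp only
    rw [hmax]
    linarith
  · have hp := MatFac.smallParams_of_le hρ hρ1 hd1 hdN hσd0 hσ hε hsq hη (by
      rw [mul_div_assoc', le_div_iff₀ (by positivity)] at hηle
      exact hηle)
    have hZs : Real.sqrt σd / 4 ≤ Z * (ρ * ε / (4 * d * Real.sqrt (d * N))) := by
      have hw : 0 < Real.sqrt (d * N) := Real.sqrt_pos.mpr (by positivity)
      have h1 : Z * (ρ * ε / (4 * d * Real.sqrt (d * N)))
          = σd * ρ / (ε * Real.sqrt (d * N)) / 4 := by
        rw [hZdef]; field_simp
      rw [h1]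
      refine div_le_div_of_nonneg_right ?_ (by norm_num)
      rw [le_div_iff₀ (by positivity)]
      refine le_of_sq_le_sq ?_ (by positivity)
      rw [mul_pow, mul_pow, Real.sq_sqrt hσd0.le, Real.sq_sqrt (by positivity)]
      have h2 : ρ ^ 4 ≤ ρ ^ 2 := pow_le_pow_of_le_one hρ.le hρ1.le (by norm_num)
      have h3 : σd * (ε ^ 2 * (d * N)) ≤ ε ^ 2 * (d * N) * σ₁ := by
        rw [mul_comm]; gcongr
      have h4 : ρ ^ 4 / 4000000 * σd * σd ≤ ρ ^ 2 / 4000000 * σd * σd := by gcongr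
      have h5 := mul_pos (pow_pos hρ 2) (mul_pos hσd0 hσd0)
      linarith
    have hZσ : 5 * (d * σ₁ ^ 2) ≤ Z ^ 2 * σd ^ 2 := by
      have h1 := pow_le_pow_left₀ (by positivity) hZκ 2
      have h2 : 0 ≤ d * σ₁ ^ 2 := by positivity
      nlinarith
    have hprob := MatFac.gaussianInit_good (Ψ := Ψ) hsvd.orthoLeft (ρ := ρ) hε
      (R := 2 * (N * d * ε ^ 2) / ρ) (by positivity) hp.s_pos.le (by
        rw [← hN]
        apply le_of_eq
        field_simp) (by
        rw [← hN]
        have hw : 0 < Real.sqrt (d * N) := Real.sqrt_pos.mpr (by positivity)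
        apply le_of_eq
        field_simp
        norm_num)
    refine hprob.trans (MeasureTheory.measure_mono ?_)
    rintro W ⟨hW1, hW2⟩ t ht
    refine MatFac.loss_le_of_lt hsvd hp ?_ hW2 hZe hZs hZσ hδ ht
    rw [Real.sq_sqrt (by positivity)]
    exact hW1
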